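/- **Setting.** All posets are finite. Let $\Phi$ be an irreducible (finite, reduced, crystallographic) root system with simple roots $\{\alpha_i\}_{i\in I}$, coroots $\alpha^\vee$, Weyl group $W$, fundamental weights $\{\omega_i\}_{i\in I}$ (dual to the simple coroots) and weight lattice $\Lambda=\bigoplus_i\mathbb Z\omega_i$. A weight is dominant if it is a nonnegative integral combination of the $\omega_i$; write $\mu\le\nu$ if $\nu-\mu$ is a nonnegative integral combination of simple roots. For dominant $\lambda$ let $\Pi(\lambda)=\{w(\nu): w\in W,\ \nu \text{ dominant},\ \nu\le\lambda\}$ with the induced order, a covering relation $\mu\to\nu$ with $\nu=\mu+\alpha_i$ having color $i$. A weight $\mu$ is *minuscule* if $\mu\neq0$ and $\langle\mu,\alpha^\vee\rangle\in\{0,\pm1\}$ for all $\alpha\in\Phi$; it is *quasi-minuscule* if $\langle\mu,\alpha^\vee\rangle\in\{0,\pm1,\pm2\}$ for all $\alpha\in\Phi$ and there is exactly one $\beta\in\Phi$ with $\langle\mu,\beta^\vee\rangle=2$. For $\lambda$ dominant and minuscule, the *minuscule splitting poset* $R(\lambda)$ is $\Pi(\lambda)$. For $\lambda$ dominant and quasi-minuscule,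 the *quasi-minuscule splitting poset* $R(\lambda)$ has the vertex set $W\lambda\sqcup\{\overline{\alpha_i}:\alpha_i\text{ a short simple root}\}$; its colored edges are those of $\Pi(\lambda)$ between elements of $W\lambda$, together with $-\alpha_i\xrightarrow{i}\overline{\alpha_i}\xrightarrow{i}\alpha_i$ for each short simple root $\alpha_i$. (If all roots have the same length, all are short.) Let $R$ be a ranked poset: there is a surjection $\rho:R\to\{0,\dots,l\}$ with $\rho(y)=\rho(x)+1$ whenever $y$ covers $x$. Let the edges $x\to y$ of its Hasse diagram be colored by $I$. For $J\subseteq I$ a $J$-component of $R$ is a connected component of the graph that keeps only the edges with colors in $J$, and a maximal element of it is one that no edge of color in $J$ leaves. For $x\in R$ let $\mathrm{comp}_i(x)$ be the $\{i\}$-component of $x$, let $l_i(x)$ be its length, $\rho_i(x)$ the rank of $x$ within it, $\delta_i(x)=l_i(x)-\rho_i(x)$, and $wt(x)=\sum_i(\rho_i(x)-\delta_i(x))\,\omega_i$. The poset $R$ is *fibrous* if every $\mathrm{comp}_i(x)$ is a chain, and *$M_\Phi$-structured* if $wt(x)+\alpha_i=wt(y)$ for every edge $x\xrightarrow{i}y$.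 Isomorphisms are those of edge-colored directed graphs. **Theorem 4.16.** *Minuscule case.* $R$ is isomorphic to a minuscule splitting poset if and only if $R$ is connected, fibrous and $M_\Phi$-structured, has at least one edge, and satisfies: 1. $l_i(x)\le1$ for all $i\in I$ and $x\in R$; 2. whenever $\langle\alpha_i,\alpha_j^\vee\rangle=0=\langle\alpha_j,\alpha_i^\vee\rangle$, every $\{i,j\}$-component of $R$ has a unique maximal element. In this case $R$ has a unique maximal element $\mathbf m$, the weight $\lambda:=wt(\mathbf m)$ is dominant and minuscule, and $R\cong R(\lambda)$. *Quasi-minuscule case.* $R$ is isomorphic to a quasi-minuscule splitting poset if and only if $R$ is connected, fibrous and $M_\Phi$-structured, has at least one edge, has $l_i(x)\ge2$ for at least one pair $i\in I$, $x\in R$, and satisfies: 1. whenever $l_i(x)\ge2$, the component $\mathrm{comp}_i(x)$ is a chain $x_0\xrightarrow{i}x_1\xrightarrow{i}x_2$ such that $\delta_j(x_0)=0=\rho_j(x_2)$ and $\mathrm{comp}_j(x_1)=\{x_1\}$ for all $j\ne i$; 2. whenever $\langle\alpha_i,\alpha_j^\vee\rangle=0=\langle\alpha_j,\alpha_i^\vee\rangle$,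 every $\{i,j\}$-component of $R$ has a unique maximal element; 3. whenever $\langle\alpha_i,\alpha_j^\vee\rangle=-1=\langle\alpha_j,\alpha_i^\vee\rangle$, every $\{i,j\}$-component of $R$ has a unique maximal element. In this case $R$ has a unique maximal element $\mathbf m$, the weight $\lambda:=wt(\mathbf m)$ is dominant and quasi-minuscule, and $R\cong R(\lambda)$. -/

import Mathlib

noncomputable section

/-- A directed graph on the vertex set `V` whose edges are colored by `I`; `G.Edge i x y` says that
there is an edge of color `i` from `x` to `y`. There are no loops, and between two vertices there is
at most one edge in a given direction, so that an edge has exactly one color. -/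
structure EdgeColoredDigraph (I V : Type*) where
  Edge : I → V → V → Prop
  loopless : ∀ i x, ¬ Edge i x x
  color_unique : ∀ {i j x y}, Edge i x y → Edge j x y → i = j

namespace EdgeColoredDigraph

variable {I V V' : Type*}

/-- Isomorphism of edge-colored directed graphs: a bijection of the vertices that preserves edges
and edge colors. -/
def Isomorphic (G : EdgeColoredDigraph I V) (G' : EdgeColoredDigraph I V') : Prop :=
  ∃ e : V ≃ V', ∀ i x y, G.Edge i x y ↔ G'.Edge i (e x) (e y)

/-- The vertex set of the `J`-component of `x`: all vertices that are joined to `x` by an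
undirected path whose edges have colors in `J`. -/
def comp (G : EdgeColoredDigraph I V) (J : Set I) (x : V) : Set V :=
  {y | Relation.EqvGen (fun u v => ∃ i ∈ J, G.Edge i u v) x y}

/-- Any two vertices are joined by an undirected path. -/
def IsConnected (G : EdgeColoredDigraph I V) : Prop :=
  ∀ x y, y ∈ G.comp Set.univ x

/-- All monochromatic components are chains (for the order generated by their own edges). -/
def IsFibrous (G : EdgeColoredDigraph I V) : Prop :=
  ∀ i x, IsChain (Relation.ReflTransGen (G.Edge i)) (G.comp {i} x)

/-- `m` is a maximal element of the `J`-component of `x`: it lies in this component, and no edge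
with a color in `J` leaves it. -/
def IsMaximalIn (G : EdgeColoredDigraph I V) (J : Set I) (x m : V) : Prop :=
  m ∈ G.comp J x ∧ ∀ i ∈ J, ∀ y, ¬ G.Edge i m y

/-- The Hasse diagram of a partially ordered set, whose edges (the covering relations) are
colored by `color`. -/
def ofColoring {R : Type*} [PartialOrder R] (color : ∀ x y : R, x ⋖ y → I) :
    EdgeColoredDigraph I R where
  Edge i x y := ∃ h : x ⋖ y, color x y h = i
  loopless := by
    rintro i x ⟨h, -⟩
    exact lt_irrefl x h.lt
  color_unique := by
    rintro i j x y ⟨h, rfl⟩ ⟨h', rfl⟩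
    rfl

end EdgeColoredDigraph

/-- A rank function of a partially ordered set `R`: a surjection of `R` onto `{0, 1, …, length}`
that increases by one along each covering relation. -/
structure RankFunction (R : Type*) [PartialOrder R] where
  length : ℕ
  rank : R → ℕ
  range_rank : Set.range rank = Set.Iic length
  rank_covBy : ∀ {x y : R}, x ⋖ y → rank y = rank x + 1

namespace RankFunction

variable {I R : Type*} [PartialOrder R] (ρ : RankFunction R) (G : EdgeColoredDigraph I R)

/-- `l_i(x)`, the length of the `i`-component of `x`. -/
def compLength (i : I) (x : R) : ℕ :=
  sSup (ρ.rank '' G.comp {i} x) - sInf (ρ.rank '' G.comp {i} x)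

/-- `ρ_i(x)`, the rank of `x` within its `i`-component. -/
def compRank (i : I) (x : R) : ℕ :=
  ρ.rank x - sInf (ρ.rank '' G.comp {i} x)

/-- `δ_i(x) = l_i(x) - ρ_i(x)`, the depth of `x` within its `i`-component. -/
def compDepth (i : I) (x : R) : ℕ :=
  ρ.compLength G i x - ρ.compRank G i x

/-- `m_i(x) = ρ_i(x) - δ_i(x) = 2 ρ_i(x) - l_i(x)`. -/
def compWeight (i : I) (x : R) : ℤ :=
  2 * (ρ.compRank G i x : ℤ) - (ρ.compLength G i x : ℤ)

end RankFunction

namespace RootPairing.Base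

variable {ι M N : Type*} [AddCommGroup M] [Module ℝ M] [AddCommGroup N] [Module ℝ N]
variable {P : RootPairing ι ℝ M N} [P.IsRootSystem] (b : P.Base)

/-- The fundamental weights, i.e. the basis dual to the simple coroots. -/
def fundamentalWeight (i : b.support) : M :=
  P.toLinearMap.toPerfPair.symm (b.toCoweightBasis.coord i)

open Classical in
theorem coroot_fundamentalWeight (i j : b.support) :
    P.coroot' j (b.fundamentalWeight i) = if i = j then 1 else 0 := by
  have h : P.toLinearMap.toPerfPair (b.fundamentalWeight i) = b.toCoweightBasis.coord i := by
    simp [fundamentalWeight]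
  have h2 := LinearMap.congr_fun h (P.coroot j)
  rw [← b.toCoweightBasis_apply] at h2
  simp [Finsupp.single_apply, eq_comm] at h2
  simpa [eq_comm] using h2

/-- The lattice of weights `Λ`, the `ℤ`-span of the fundamental weights. -/
def weightLattice : AddSubgroup M :=
  AddSubgroup.closure (Set.range b.fundamentalWeight)

/-- Dominant weights: nonnegative integral combinations of the fundamental weights. -/
def IsDominant (μ : M) : Prop :=
  ∃ a : b.support → ℕ, μ = ∑ i, a i • b.fundamentalWeight i

/-- The order on weights: `μ ≤ ν` if `ν - μ` is a nonnegative integral combination of simple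
roots. -/
def WeightLE (μ ν : M) : Prop :=
  ∃ k : b.support → ℕ, ν - μ = ∑ i, k i • P.root i

/-- The weight diagram `Π(lam)`: the Weyl group orbits of the dominant weights `ν ≤ lam`. -/
def weightDiagram (lam : M) : Set M :=
  {μ | ∃ (w : P.weylGroup) (ν : M), b.IsDominant ν ∧ b.WeightLE ν lam ∧ μ = w • ν}

/-- The edge `μ → ν` of color `i` in `Π(lam)`: the element `ν` covers `μ` in `Π(lam)` (with the
order induced from the weights), and `ν = μ + α_i`. -/
def WeightDiagramEdge (lam : M) (i : b.support) (μ ν : M) : Prop :=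
  μ ∈ b.weightDiagram lam ∧ ν ∈ b.weightDiagram lam ∧
  (b.WeightLE μ ν ∧ μ ≠ ν ∧
    ∀ ξ ∈ b.weightDiagram lam, b.WeightLE μ ξ → b.WeightLE ξ ν → ξ = μ ∨ ξ = ν) ∧
  ν = μ + P.root i

/-- Minuscule weights: nonzero weights whose pairings with all coroots lie in `{0, 1, -1}`. -/
def IsMinuscule (μ : M) : Prop :=
  μ ∈ b.weightLattice ∧ μ ≠ 0 ∧ ∀ k : ι, P.coroot' k μ ∈ ({0, 1, -1} : Set ℝ)

/-- Quasi-minuscule weights: the pairings with all coroots lie in `{0, 1, -1, 2, -2}`, and the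
value `2` is attained for exactly one root. -/
def IsQuasiMinuscule (μ : M) : Prop :=
  μ ∈ b.weightLattice ∧ (∀ k : ι, P.coroot' k μ ∈ ({0, 1, -1, 2, -2} : Set ℝ)) ∧
    ∃! k : ι, P.coroot' k μ = 2

variable [Fintype ι]

/-- The simple root `α_i` is short: no root is shorter. (Lengths are measured with the canonical
Weyl group invariant inner product; for an irreducible root system all invariant inner products are
proportional. If all roots have the same length, then all are short.) -/
def IsShort (i : b.support) : Prop :=
  ∀ k : ι, P.RootForm (P.root i) (P.root i) ≤ P.RootForm (P.root k) (P.root k)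

/-- `R(lam)` for a dominant minuscule weight `lam`: the weight diagram `Π(lam)`. -/
def minusculePoset (lam : M) : EdgeColoredDigraph b.support (b.weightDiagram lam) where
  Edge i μ ν := b.WeightDiagramEdge lam i μ ν
  loopless := by
    rintro i μ ⟨-, -, ⟨-, h, -⟩, -⟩
    exact h rfl
  color_unique := by
    rintro i j μ ν ⟨-, -, -, h⟩ ⟨-, -, -, h'⟩
    exact Subtype.ext (P.root.injective (add_left_cancel (h.symm.trans h')))

/-- `R(lam)` for a dominant quasi-minuscule weight `lam`. The vertices are the weights in the Weyl
group orbit of `lam` (`Sum.inl`), and one extra vertex `ᾱ_i` for each short simple root `α_i`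
(`Sum.inr`). The edges are those of `Π(lam)` between weights in the orbit, and the edges
`-α_i → ᾱ_i → α_i` of color `i`. -/
def quasiMinusculePoset (lam : M) :
    EdgeColoredDigraph b.support
      (MulAction.orbit P.weylGroup lam ⊕ {i : b.support // b.IsShort i}) where
  Edge i x y :=
    match x, y with
    | Sum.inl μ, Sum.inl ν => b.WeightDiagramEdge lam i μ ν
    | Sum.inl μ, Sum.inr j => j.1 = i ∧ (μ : M) = -P.root i
    | Sum.inr j, Sum.inl ν => j.1 = i ∧ (ν : M) = P.root i
    | Sum.inr _, Sum.inr _ => False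
  loopless := by
    rintro i (μ | j) h
    · obtain ⟨-, -, ⟨-, h, -⟩, -⟩ := h
      exact h rfl
    · exact h
  color_unique := by
    rintro i j (μ | k) (ν | l) h h'
    · obtain ⟨-, -, -, h⟩ := h
      obtain ⟨-, -, -, h'⟩ := h'
      exact Subtype.ext (P.root.injective (add_left_cancel (h.symm.trans h')))
    · exact h.1.symm.trans h'.1
    · exact h.1.symm.trans h'.1
    · exact h.elim

variable {R : Type*} [PartialOrder R]

/-- The weight `wt(x) = ∑ i, m_i(x) ω_i` of an element of a ranked poset whose edges are colored by
the simple roots. -/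
def wt (ρ : RankFunction R) (G : EdgeColoredDigraph b.support R) (x : R) : M :=
  ∑ i, ρ.compWeight G i x • b.fundamentalWeight i

/-- `R` is `M_Φ`-structured: `wt(x) + α_i = wt(y)` for each edge `x → y` of color `i`. -/
def IsStructured (ρ : RankFunction R) (G : EdgeColoredDigraph b.support R) : Prop :=
  ∀ i x y, G.Edge i x y → b.wt ρ G x + P.root i = b.wt ρ G y

end RootPairing.Base

end

/-! The weight of a vertex records its position in all monochromatic strings, and the proof shows
that it determines the vertex, except at weight zero.

From the local conditions to the poset (`IsLocallySplitting`). Every `i`-component is a point, an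
edge, or a chain -α_i → 0 → α_i (`classification`), so it realizes the reflection s_i on weights. If
edges of two colors `i ≠ j` leave one vertex, then ⟨wt, α_i^∨⟩ = ⟨wt, α_j^∨⟩ = -1 there. Crossing
one edge changes the other pairing by a Cartan integer and cannot bring it below -2, so α_i and α_j
span A₁ × A₁ or A₂ (`cartanMatrix_of_edge_of_edge`). These are the cases in which unique maxima are
assumed. Newman's diamond lemma (`EdgeColoredDigraph.IsConnected.existsUnique_isMax`) then yields a
unique maximal element `m`. Any other vertex of nonzero weight has a negative pairing with some
simple coroot and can be reflected upwards. Downward induction from `m` shows that nonzero weights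
fill exactly the Weyl orbit of wt(m), each once, and that they determine the edges between their
vertices. The vertices of weight zero are the middles of long chains, one for each short simple
root. Since every root is conjugate to a simple one, bounds on pairings with simple coroots over the
orbit bound all pairings of wt(m).

From the poset to the local conditions (`IsWeightModel`). Fibrousness, structure and connectedness
follow from the explicit strings. For uniqueness of maxima, compare two maximal elements of nonzero
weights μ, ν in an {i,j}-component. Their difference is sα_i + tα_j, and both pair with α_i^∨ and
α_j^∨ in [0,2]. Put the root α_i in place of the weight zero at the middle of a long `i`-chain: then
along each edge the label is either reflected or kept, so every function invariant under s_i and s_j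
agrees at μ and ν. Absolute values of pairings settle A₁ × A₁. The invariant norm settles A₂ when s
and t do not have opposite signs, and the bound 2 excludes opposite signs.

The link with roots is that a quasi-minuscule weight is itself a shortest root
(`eq_root_of_coroot'_eq_two_iff`, `rootForm_le_of_coroot'_eq_two_iff`), and that roots of equal
length are conjugate (`root_mem_orbit_of_rootForm_eq`). -/

noncomputable section

open MulAction (orbit)

/-! ### Weyl orbits, the invariant form and root lengths -/

namespace RootPairing

variable {ι M N : Type*} [AddCommGroup M] [Module ℝ M] [AddCommGroup N] [Module ℝ N]
variable {P : RootPairing ι ℝ M N}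

theorem reflection_mem_orbit {lam μ : M} (k : ι) (h : μ ∈ orbit P.weylGroup lam) :
    P.reflection k μ ∈ orbit P.weylGroup lam := by
  have : P.reflection k μ = weylGroup.ofIdx P k • μ := by simp
  rw [this]
  exact MulAction.mem_orbit_of_mem_orbit _ h

theorem orbit_subset_of_reflection_mem {S : Set M}
    (hS : ∀ k, ∀ μ ∈ S, P.reflection k μ ∈ S) {lam : M} (hlam : lam ∈ S) :
    orbit P.weylGroup lam ⊆ S := by
  rintro _ ⟨⟨g, hg⟩, rfl⟩
  suffices ∀ μ ∈ S, (⟨g, hg⟩ : P.weylGroup) • μ ∈ S from this _ hlam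
  induction hg using weylGroup.induction with
  | mem i => intro μ hμ; simpa using hS i μ hμ
  | one => intro μ hμ; simpa using hμ
  | mul g₁ g₂ hg₁ hg₂ h₁ h₂ =>
    intro μ hμ
    rw [← Submonoid.mk_mul_mk _ _ _ hg₁ hg₂, mul_smul]
    exact h₁ _ (h₂ _ hμ)

theorem reflection_root_of_reflectionPerm_self (k : ι) (x : M) :
    P.reflection (P.reflectionPerm k k) x = P.reflection k x := by
  rw [reflection_reflectionPerm]
  simp

theorem root_reflectionPerm_eq_iff (j k : ι) (μ : M) :
    μ = P.root (P.reflectionPerm j k) ↔ P.reflection j μ = P.root k := by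
  rw [root_reflectionPerm]
  constructor
  · rintro rfl; simp
  · intro h; rw [← h]; simp

section Form

variable [Fintype ι]

/-- Apply invariance of the form under s_i to the pair (x, α_i). -/
theorem two_mul_rootForm_root (x : M) (i : ι) :
    2 * P.RootForm x (P.root i) = P.coroot' i x * P.RootForm (P.root i) (P.root i) := by
  have h := P.rootForm_reflection_reflection_apply i x (P.root i)
  rw [reflection_apply_self, reflection_apply] at h
  simp only [map_neg, map_sub, LinearMap.sub_apply, map_smul, LinearMap.smul_apply,
    smul_eq_mul] at h
  linarith

theorem rootForm_root_pos [P.IsRootSystem] (i : ι) : 0 < P.RootForm (P.root i) (P.root i) :=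
  P.rootForm_pos_of_ne_zero (by simp) (P.ne_zero i)

theorem rootForm_comm (x y : M) : P.RootForm x y = P.RootForm y x := by
  simp only [rootForm_apply_apply, mul_comm]

theorem rootForm_eq_of_mem_orbit {lam μ : M} (h : μ ∈ orbit P.weylGroup lam) :
    P.RootForm μ μ = P.RootForm lam lam :=
  orbit_subset_of_reflection_mem (P := P) (S := {μ | P.RootForm μ μ = P.RootForm lam lam})
    (by intro k μ hμ; simpa using hμ) rfl h

variable [P.IsRootSystem]

/-- Both (μ, μ-ν) and (ν, μ-ν) are nonnegative, and their sum is |μ|² - |ν|² = 0. Both therefore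
vanish, hence so does |μ-ν|². -/
theorem eq_of_rootForm_eq_of_nonneg {μ ν : M} {i j : ι} {s t : ℝ}
    (h : μ - ν = s • P.root i + t • P.root j) (hs : 0 ≤ s) (ht : 0 ≤ t)
    (hμi : 0 ≤ P.coroot' i μ) (hμj : 0 ≤ P.coroot' j μ)
    (hνi : 0 ≤ P.coroot' i ν) (hνj : 0 ≤ P.coroot' j ν)
    (hn : P.RootForm μ μ = P.RootForm ν ν) : μ = ν := by
  have hform (x : M) (hi : 0 ≤ P.coroot' i x) (hj : 0 ≤ P.coroot' j x) :
      0 ≤ P.RootForm x (μ - ν) := by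
    have hi' := two_mul_rootForm_root (P := P) x i
    have hj' := two_mul_rootForm_root (P := P) x j
    have h1 : 0 ≤ P.RootForm x (P.root i) := by
      have := mul_nonneg hi (P.zero_le_rootForm (P.root i))
      linarith
    have h2 : 0 ≤ P.RootForm x (P.root j) := by
      have := mul_nonneg hj (P.zero_le_rootForm (P.root j))
      linarith
    rw [h]
    simp only [map_add, map_smul, smul_eq_mul]
    positivity
  have h1 := hform μ hμi hμj
  have h2 := hform ν hνi hνj
  have h3 : P.RootForm μ ν = P.RootForm ν μ := rootForm_comm μ ν
  have h4 : P.RootForm (μ - ν) (μ - ν) = 0 := by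
    simp only [map_sub, LinearMap.sub_apply] at h1 h2 ⊢
    linarith
  exact sub_eq_zero.mp (P.eq_zero_of_mem_rootSpan_of_rootForm_self_eq_zero (by simp) h4)

/-- By irreducibility the orbit of α_k spans, so it contains a root α_l that is not orthogonal to
α_j. These have equal length, so they are equal, opposite, or span A₂; in each case explicit
reflections carry α_l to α_j. -/
theorem root_mem_orbit_of_rootForm_eq [P.IsCrystallographic] [P.IsReduced] [P.IsIrreducible]
    {j k : ι} (h : P.RootForm (P.root j) (P.root j) = P.RootForm (P.root k) (P.root k)) :
    P.root j ∈ orbit P.weylGroup (P.root k) := by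
  obtain ⟨l, hl, hlk⟩ : ∃ l, P.root l ∈ orbit P.weylGroup (P.root k) ∧
      P.RootForm (P.root j) (P.root l) ≠ 0 := by
    by_contra! contra
    have h1 : Submodule.span ℝ (orbit P.weylGroup (P.root k)) ≤
        LinearMap.ker (P.RootForm (P.root j)) := by
      refine Submodule.span_le.mpr fun v hv ↦ ?_
      obtain ⟨g, rfl⟩ := MulAction.mem_orbit_iff.mp hv
      have := contra (P.weylGroupToPerm g k) (by rw [← weylGroup_apply_root]; exact hv)
      rw [← weylGroup_apply_root] at this
      exact this
    rw [span_orbit_eq_top] at h1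
    have h2 : P.RootForm (P.root j) (P.root j) = 0 := h1 (Submodule.mem_top (x := P.root j))
    exact (rootForm_root_pos (P := P) j).ne' h2
  have hlen := (rootForm_eq_of_mem_orbit hl).trans h.symm
  have hcases := P.pairingIn_pairingIn_mem_set_of_length_eq (B := P.toInvariantForm)
    (i := l) (j := j) hlen
  have hne : P.pairing l j ≠ 0 := by
    intro h0
    have := two_mul_rootForm_root (P := P) (P.root l) j
    rw [root_coroot'_eq_pairing, h0, rootForm_comm] at this
    apply hlk
    linarith
  have e1 := P.algebraMap_pairingIn ℤ l j
  have e2 := P.algebraMap_pairingIn ℤ j l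
  simp only [Set.mem_insert_iff, Set.mem_singleton_iff, Prod.mk.injEq] at hcases
  rcases hcases with ⟨h1, h2⟩ | ⟨h1, h2⟩ | ⟨h1, h2⟩ | ⟨h1, h2⟩ | ⟨h1, h2⟩ <;>
    rw [h1] at e1 <;> rw [h2] at e2 <;> simp only [algebraMap_int_eq, map_zero, map_one, map_neg,
      map_ofNat] at e1 e2
  · exact absurd e1.symm hne
  · have h3 := reflection_mem_orbit j (reflection_mem_orbit l (reflection_mem_orbit j hl))
    convert h3 using 1
    have r1 : P.reflection j (P.root l) = P.root l - P.root j := by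
      rw [reflection_apply_root, ← e1, one_smul]
    have r2 : P.reflection l (P.root j) = P.root j - P.root l := by
      rw [reflection_apply_root, ← e2, one_smul]
    simp only [r1, r2, map_sub, reflection_apply_self, map_neg]
    abel
  · have h3 := reflection_mem_orbit l (reflection_mem_orbit j hl)
    simpa [reflection_apply_root, ← e1, ← e2] using h3
  · have : l = j := (P.pairingIn_two_two_iff ℤ _ _).mp ⟨h1, h2⟩
    exact this ▸ hl
  · have : P.root l = -P.root j := (P.pairingIn_neg_two_neg_two_iff ℤ _ _).mp ⟨h1, h2⟩
    have h3 := reflection_mem_orbit j hl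
    simpa [this] using h3

end Form

end RootPairing

/-! ### Minuscule and quasi-minuscule weights -/

namespace RootPairing

variable {ι M N : Type*} [AddCommGroup M] [Module ℝ M] [AddCommGroup N] [Module ℝ N]
variable {P : RootPairing ι ℝ M N}

theorem pairing_eq_intCast [P.IsCrystallographic] (i j : ι) :
    ∃ z : ℤ, P.pairing i j = z :=
  ⟨P.pairingIn ℤ i j, (P.algebraMap_pairingIn ℤ i j).symm⟩

theorem coroot'_reflectionPerm_self (k : ι) (μ : M) :
    P.coroot' (P.reflectionPerm k k) μ = -P.coroot' k μ := by
  rw [← coroot'_reflection, reflection_apply, map_sub, map_smul, root_coroot'_eq_pairing,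
    pairing_same, smul_eq_mul]
  ring

/-- Let α_j^∨ lie outside the span. Then s_j fixes α_k and preserves the set of γ. If γ in the set
paired nontrivially with α_j, the difference of γ^∨ and its reflection would be a nonzero multiple
of α_j^∨ in the span. So coroots outside the span are orthogonal to the set, and irreducibility
leaves none. -/
theorem span_coroot_pairing_ne_zero [P.IsRootSystem] [P.IsIrreducible] (k : ι) :
    Submodule.span ℝ (P.coroot '' {γ | P.pairing k γ ≠ 0}) = ⊤ := by
  refine P.flip.span_root_image_eq_top_of_forall_orthogonal _ ⟨k, by simp⟩ fun j hj i hi ↦ ?_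
  have hkj : P.pairing k j = 0 := by
    by_contra h
    exact hj (Submodule.subset_span ⟨j, h, rfl⟩)
  suffices h : P.pairing j i = 0 from ⟨P.pairing_eq_zero_iff.mp h, h⟩
  by_contra hji
  have hmem : P.reflectionPerm j i ∈ {γ | P.pairing k γ ≠ 0} := by
    have h1 : P.reflection j (P.root k) = P.root k := by simp [reflection_apply_root, hkj]
    have h2 : P.pairing k (P.reflectionPerm j i) = P.pairing k i := by
      rw [← root_coroot'_eq_pairing, ← coroot'_reflection, h1, root_coroot'_eq_pairing]
    rw [Set.mem_ofPred_eq, h2]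
    exact hi
  have h1 : P.coroot (P.reflectionPerm j i) = P.coroot i - P.pairing j i • P.coroot j :=
    (P.reflectionPerm_coroot j i).symm
  have h2 : P.pairing j i • P.coroot j = P.coroot i - P.coroot (P.reflectionPerm j i) := by
    rw [h1]; abel
  apply hj
  refine (Submodule.smul_mem_iff _ hji).mp ?_
  change P.pairing j i • P.coroot j ∈ _
  rw [h2]
  exact Submodule.sub_mem _ (Submodule.subset_span ⟨i, hi, rfl⟩)
    (Submodule.subset_span ⟨_, hmem, rfl⟩)

/-- If the pairings of `lam` with the coroots are at most two in absolute value, and the value two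
is attained exactly once, then it is attained at the coroot of `lam`, which is a root. -/
theorem eq_root_of_coroot'_eq_two_iff [P.IsRootSystem] [P.IsCrystallographic] [P.IsIrreducible]
    {lam : M} {k : ι} (hlam : ∀ l, P.coroot' l lam ∈ ({0, 1, -1, 2, -2} : Set ℝ))
    (hk : ∀ l, P.coroot' l lam = 2 ↔ l = k) : lam = P.root k := by
  have hneg (l : ι) : P.coroot' l lam = -2 → P.reflectionPerm l l = k := by
    intro h
    rw [← hk, coroot'_reflectionPerm_self, h, neg_neg]
  -- The cases γ = ±α_k come first, because only there is the value ±2 taken.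
  have hs : ∀ γ, P.pairing k γ ≠ 0 → P.coroot' γ lam = P.pairing k γ := by
    intro γ hγ
    have hkk : P.coroot' k lam = 2 := (hk k).mpr rfl
    rcases eq_or_ne γ k with rfl | hne
    · rw [hkk, pairing_same]
    rcases eq_or_ne (P.reflectionPerm γ γ) k with rfl | hne'
    · rw [pairing_reflectionPerm_self_left, pairing_same]
      rw [coroot'_reflectionPerm_self] at hkk
      linarith
    have h1 := hlam γ
    have h2 := hlam (P.reflectionPerm k γ)
    have h3 : P.coroot' (P.reflectionPerm k γ) lam ≠ 2 := by
      rw [Ne, hk]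
      intro h
      apply hne'
      have h' := (P.reflectionPerm k).symm_apply_eq.mpr h.symm
      rw [reflectionPerm_symm] at h'
      have : P.reflectionPerm γ γ = k := by
        apply P.root.injective
        rw [← h']
        simp [reflection_root_of_reflectionPerm_self]
      exact this
    have h4 : P.coroot' (P.reflectionPerm k γ) lam ≠ -2 := by
      intro h
      have h' := hneg _ h
      apply hne
      apply P.root.injective
      have h5 := congrArg P.root h'
      simp only [root_reflectionPerm, reflection_reflectionPerm] at h5
      have h6 := congrArg (P.reflection k) h5
      simpa using h6
    have h5 : P.coroot' γ lam ≠ 2 := by rwa [Ne, hk]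
    have h6 : P.coroot' γ lam ≠ -2 := fun h ↦ hne' (hneg _ h)
    -- With c = ⟨lam, γ^∨⟩ and p = ⟨α_k, γ^∨⟩, the pairing of `lam` with the coroot of s_k γ is c -
    -- 2p. Both c and c - 2p lie in {0, ±1} and p is a nonzero integer, which forces c = p = ±1.
    rw [← coroot'_reflection, reflection_apply, hkk, map_sub, map_smul, root_coroot'_eq_pairing,
      smul_eq_mul] at h2 h3 h4
    obtain ⟨z, hz⟩ := P.pairing_eq_intCast k γ
    rw [hz] at h2 h3 h4 hγ ⊢
    have hz0 : z ≠ 0 := by exact_mod_cast hγ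
    have : z = 1 ∨ z = -1 ∨ 2 ≤ z ∨ z ≤ -2 := by omega
    simp only [Set.mem_insert_iff, Set.mem_singleton_iff] at h1 h2
    rcases this with rfl | rfl | hz | hz
    · push_cast at *
      grind
    · push_cast at *
      grind
    · have : (2 : ℝ) ≤ z := by exact_mod_cast hz
      grind
    · have : (z : ℝ) ≤ -2 := by exact_mod_cast hz
      grind
  rw [← sub_eq_zero, P.eq_zero_iff_forall_coroot'_eq_zero]
  intro i
  have hspan : Submodule.span ℝ (P.coroot '' {γ | P.pairing k γ ≠ 0}) ≤
      LinearMap.ker (P.toLinearMap (lam - P.root k)) := by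
    refine Submodule.span_le.mpr ?_
    rintro _ ⟨γ, hγ, rfl⟩
    have h1 := hs γ hγ
    have h2 : P.coroot' γ (lam - P.root k) = 0 := by
      rw [map_sub, h1, root_coroot'_eq_pairing, sub_self]
    exact h2
  rw [span_coroot_pairing_ne_zero] at hspan
  exact hspan (Submodule.mem_top (x := P.coroot i))

/-- Replace α_j by a root α_l of the same length that is not orthogonal to α_k. Unless α_l = ±α_k,
⟨α_k, α_l^∨⟩ = ±1, so ±|α_l|² = 2(α_k, α_l) = ⟨α_l, α_k^∨⟩|α_k|² with a nonzero integer factor on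
the right. -/
theorem rootForm_le_of_coroot'_eq_two_iff [Fintype ι] [P.IsRootSystem] [P.IsCrystallographic]
    [P.IsIrreducible] {k : ι}
    (hroot : ∀ l, P.coroot' l (P.root k) ∈ ({0, 1, -1, 2, -2} : Set ℝ))
    (hk : ∀ l, P.coroot' l (P.root k) = 2 ↔ l = k) (j : ι) :
    P.RootForm (P.root k) (P.root k) ≤ P.RootForm (P.root j) (P.root j) := by
  obtain ⟨l, hl, hkl⟩ := P.exists_form_eq_form_and_form_ne_zero P.toInvariantForm k j
  simp only [toInvariantForm_form] at hl hkl
  rw [← hl]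
  have h1 := two_mul_rootForm_root (P := P) (P.root k) l
  have h2 := two_mul_rootForm_root (P := P) (P.root l) k
  rw [rootForm_comm, h1, root_coroot'_eq_pairing, root_coroot'_eq_pairing] at h2
  have hne : P.pairing k l ≠ 0 := by
    intro h
    rw [root_coroot'_eq_pairing, h] at h1
    apply hkl
    linarith
  have hpos := rootForm_root_pos (P := P) k
  have hpos' := rootForm_root_pos (P := P) l
  have hroot' := hroot l
  rw [root_coroot'_eq_pairing] at hroot'
  rcases eq_or_ne (P.pairing k l) 2 with h | h
  · have : l = k := by rwa [← hk, root_coroot'_eq_pairing]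
    rw [this]
  rcases eq_or_ne (P.pairing k l) (-2) with h' | h'
  · have : P.reflectionPerm l l = k := by
      rw [← hk, coroot'_reflectionPerm_self, root_coroot'_eq_pairing, h', neg_neg]
    rw [← this]
    simp
  obtain ⟨z, hz⟩ := P.pairing_eq_intCast l k
  rw [hz] at h2
  have hz0 : z ≠ 0 := by
    rintro rfl
    simp only [Int.cast_zero, zero_mul, mul_eq_zero] at h2
    rcases h2 with h2 | h2
    · exact hne h2
    · exact hpos'.ne' h2
  simp only [Set.mem_insert_iff, Set.mem_singleton_iff, hne, h, h', or_false, false_or] at hroot'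
  rcases hroot' with hr | hr <;> rw [hr] at h2
  · rcases lt_or_gt_of_ne hz0 with hz1 | hz1
    · have : (z : ℝ) ≤ -1 := by exact_mod_cast Int.le_sub_one_of_lt hz1
      nlinarith
    · have : (1 : ℝ) ≤ z := by exact_mod_cast hz1
      nlinarith
  · rcases lt_or_gt_of_ne hz0 with hz1 | hz1
    · have : (z : ℝ) ≤ -1 := by exact_mod_cast Int.le_sub_one_of_lt hz1
      nlinarith
    · have : (1 : ℝ) ≤ z := by exact_mod_cast hz1
      nlinarith

theorem coroot'_mem_of_mem_orbit {s : Set ℝ} {lam : M} (h : ∀ k, P.coroot' k lam ∈ s) {μ : M}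
    (hμ : μ ∈ orbit P.weylGroup lam) : ∀ k, P.coroot' k μ ∈ s :=
  orbit_subset_of_reflection_mem (P := P) (S := {μ | ∀ k, P.coroot' k μ ∈ s})
    (fun k μ hμ l ↦ by rw [coroot'_reflection]; exact hμ _) h hμ

namespace Base

variable (b : P.Base)

/-- The reflection in s_j(β) is s_j s_β s_j, so simple reflections generate all of them. -/
theorem forall_reflection_mem [Finite ι] [P.IsCrystallographic] [P.IsReduced] {S : Set M}
    (hS : ∀ i ∈ b.support, ∀ μ ∈ S, P.reflection i μ ∈ S) (k : ι) :
    ∀ μ ∈ S, P.reflection k μ ∈ S := by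
  refine b.induction_reflect k ?_ hS ?_
  · intro i hi μ hμ
    rw [reflection_root_of_reflectionPerm_self]
    exact hi μ hμ
  · intro i j hi hj μ hμ
    rw [reflection_reflectionPerm]
    exact hS j hj _ (hi _ (hS j hj _ hμ))

/-- Move the root to a simple one and the weight along with it. This turns conditions on all coroots
at one weight into conditions on simple coroots over a whole orbit. The last clause is carried along
to locate the root at which the value 2 is attained. -/
theorem exists_simple_coroot'_eq [Finite ι] [P.IsCrystallographic] [P.IsReduced] {S : Set M}
    (hS : ∀ i ∈ b.support, ∀ μ ∈ S, P.reflection i μ ∈ S) (k : ι) :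
    ∀ μ ∈ S, ∃ i ∈ b.support, ∃ ν ∈ S, P.coroot' k μ = P.coroot' i ν ∧
      (μ = P.root k ↔ ν = P.root i) := by
  have key (i j : ι) (h : ∀ μ ∈ S, ∃ l ∈ b.support, ∃ ν ∈ S, P.coroot' i μ = P.coroot' l ν ∧
      (μ = P.root i ↔ ν = P.root l)) : ∀ μ ∈ S, ∃ l ∈ b.support, ∃ ν ∈ S,
        P.coroot' (P.reflectionPerm j i) μ = P.coroot' l ν ∧
        (μ = P.root (P.reflectionPerm j i) ↔ ν = P.root l) := by
    intro μ hμ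
    obtain ⟨l, hl, ν, hν, h1, h2⟩ := h _ (b.forall_reflection_mem hS j μ hμ)
    refine ⟨l, hl, ν, hν, ?_, ?_⟩
    · rw [← coroot'_reflection, h1]
    · rw [root_reflectionPerm_eq_iff, h2]
  refine b.induction_reflect k (fun i hi ↦ key i i hi) ?_ (fun i j hi _ ↦ key i j hi)
  exact fun i hi μ hμ ↦ ⟨i, hi, μ, hμ, rfl, Iff.rfl⟩

theorem exists_mem_orbit_simple_root [Finite ι] [P.IsCrystallographic] [P.IsReduced] (k : ι) :
    ∃ i ∈ b.support, P.root i ∈ orbit P.weylGroup (P.root k) := by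
  obtain ⟨i, hi, ν, hν, -, h⟩ := b.exists_simple_coroot'_eq
    (S := orbit P.weylGroup (P.root k)) (fun i _ μ hμ ↦ reflection_mem_orbit i hμ) k _
    (MulAction.mem_orbit_self _)
  exact ⟨i, hi, h.mp rfl ▸ hν⟩

theorem WeightLE.refl (μ : M) : b.WeightLE μ μ := ⟨0, by simp⟩

variable [P.IsRootSystem]

/-- For β = Σ k_i α_i ≠ 0, the expansion of (β, β) > 0 must have a positive term k_i (β, α_i). -/
theorem exists_pos_coroot'_sum [Fintype ι] (k : b.support → ℕ)
    (h : ∑ i, k i • P.root i ≠ 0) :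
    ∃ i, 0 < k i ∧ 0 < P.coroot' i (∑ i, k i • P.root i) := by
  by_contra! contra
  set β := ∑ i, k i • P.root i with hβ
  have hpos : 0 < P.RootForm β β := P.rootForm_pos_of_ne_zero (by simp) h
  have hle : P.RootForm β β ≤ 0 := by
    conv_lhs => rw [hβ]
    rw [rootForm_comm, ← hβ, hβ, map_sum, ← hβ]
    refine Finset.sum_nonpos fun i _ ↦ ?_
    rw [map_nsmul, nsmul_eq_mul]
    rcases Nat.eq_zero_or_pos (k i) with h0 | h0
    · simp [h0]
    · have h1 := contra i h0
      have h2 := two_mul_rootForm_root (P := P) β i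
      have h3 := rootForm_root_pos (P := P) i
      have h4 : P.RootForm β (P.root i) ≤ 0 := by nlinarith
      exact mul_nonpos_of_nonneg_of_nonpos (by positivity) h4
  linarith

variable {b}

theorem IsDominant.coroot'_nonneg {μ : M} (h : b.IsDominant μ) (i : b.support) :
    0 ≤ P.coroot' i μ := by
  classical
  obtain ⟨a, rfl⟩ := h
  simp only [map_sum, map_nsmul, coroot_fundamentalWeight]
  simp

theorem IsDominant.orbit_subset_weightDiagram {lam : M} (h : b.IsDominant lam) :
    orbit P.weylGroup lam ⊆ b.weightDiagram lam := by
  rintro _ ⟨g, rfl⟩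
  exact ⟨g, lam, h, WeightLE.refl b lam, rfl⟩

/-- A dominant ν ≤ `lam` is reached from `lam` by simple reflections. If μ in the orbit lies above
ν, some α_i occurring in μ - ν pairs positively with it. Then ⟨μ, α_i^∨⟩ = 1 by dominance of ν, so
s_i μ = μ - α_i is one step closer. -/
theorem IsMinuscule.weightDiagram_eq [Fintype ι] {lam : M} (h : b.IsMinuscule lam)
    (hd : b.IsDominant lam) : b.weightDiagram lam = orbit P.weylGroup lam := by
  classical
  refine Set.Subset.antisymm ?_ hd.orbit_subset_weightDiagram
  rintro _ ⟨g, ν, hν, ⟨k, hk⟩, rfl⟩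
  refine MulAction.mem_orbit_of_mem_orbit g ?_
  suffices ∀ n, ∀ μ ∈ orbit P.weylGroup lam, ∀ k : b.support → ℕ, ∑ i, k i = n →
      μ - ν = ∑ i, k i • P.root i → ν ∈ orbit P.weylGroup lam from
    this _ lam (MulAction.mem_orbit_self _) k rfl hk
  intro n
  induction n with
  | zero =>
    intro μ hμ k hk hμν
    have : ∀ i, k i = 0 := by simpa using hk
    simp only [this, zero_smul, Finset.sum_const_zero, sub_eq_zero] at hμν
    exact hμν ▸ hμ
  | succ n ih =>
    intro μ hμ k hk hμν
    by_cases h0 : ∑ i, k i • P.root i = 0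
    · rw [h0, sub_eq_zero] at hμν
      exact hμν ▸ hμ
    obtain ⟨i, hki, hi⟩ := b.exists_pos_coroot'_sum k h0
    rw [← hμν, map_sub] at hi
    have h1 := hν.coroot'_nonneg i
    have h2 : P.coroot' i μ = 1 := by
      have := coroot'_mem_of_mem_orbit h.2.2 hμ i
      simp only [Set.mem_insert_iff, Set.mem_singleton_iff] at this
      rcases this with h | h | h <;> linarith
    refine ih _ (reflection_mem_orbit (i : ι) hμ) (Function.update k i (k i - 1)) ?_ ?_
    · have h3 := Finset.sum_update_of_mem (Finset.mem_univ i) k (k i - 1)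
      have h4 := Finset.add_sum_erase Finset.univ k (Finset.mem_univ i)
      rw [Finset.sdiff_singleton_eq_erase] at h3
      omega
    · have h3 : ∀ j, Function.update k i (k i - 1) j • P.root j =
          k j • P.root j - (if j = i then P.root i else 0) := by
        intro j
        by_cases hj : j = i
        · subst hj
          obtain ⟨m, hm⟩ := Nat.exists_eq_succ_of_ne_zero hki.ne'
          simp [hm, add_smul]
        · simp [hj]
      simp only [h3, Finset.sum_sub_distrib, ← hμν]
      rw [reflection_apply, h2]
      simp
      abel

theorem IsQuasiMinuscule.exists_eq_root [P.IsCrystallographic] [P.IsIrreducible] {lam : M}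
    (h : b.IsQuasiMinuscule lam) :
    ∃ k, lam = P.root k ∧ ∀ l, P.coroot' l lam = 2 ↔ l = k := by
  obtain ⟨-, h1, k, hk, hk'⟩ := h
  have hiff : ∀ l, P.coroot' l lam = 2 ↔ l = k := fun l ↦ ⟨hk' l, fun h ↦ h ▸ hk⟩
  exact ⟨k, eq_root_of_coroot'_eq_two_iff h1 hiff, hiff⟩

theorem IsQuasiMinuscule.coroot'_eq_two_iff [P.IsCrystallographic] [P.IsIrreducible] {lam : M}
    (h : b.IsQuasiMinuscule lam) {μ : M} (hμ : μ ∈ orbit P.weylGroup lam) :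
    ∀ l, P.coroot' l μ = 2 ↔ μ = P.root l := by
  obtain ⟨k, rfl, hk⟩ := h.exists_eq_root
  refine orbit_subset_of_reflection_mem (P := P)
    (S := {μ | ∀ l, P.coroot' l μ = 2 ↔ μ = P.root l}) (fun k μ hμ l ↦ ?_) (fun l ↦ ?_) hμ
  · rw [coroot'_reflection, hμ, root_reflectionPerm_eq_iff]
  · rw [hk, P.root.injective.eq_iff, eq_comm]

theorem IsQuasiMinuscule.coroot'_eq_neg_two_iff [P.IsCrystallographic] [P.IsIrreducible] {lam : M}
    (h : b.IsQuasiMinuscule lam) {μ : M} (hμ : μ ∈ orbit P.weylGroup lam) (l : ι) :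
    P.coroot' l μ = -2 ↔ μ = -P.root l := by
  have := h.coroot'_eq_two_iff hμ (P.reflectionPerm l l)
  rw [coroot'_reflectionPerm_self, root_reflectionPerm, reflection_apply_self] at this
  rw [← this]
  constructor <;> intro h <;> linarith

theorem IsQuasiMinuscule.ne_zero_of_mem_orbit [P.IsCrystallographic] [P.IsIrreducible] {lam : M}
    (h : b.IsQuasiMinuscule lam) {μ : M} (hμ : μ ∈ orbit P.weylGroup lam) : μ ≠ 0 := by
  obtain ⟨k, rfl, hk⟩ := h.exists_eq_root
  refine orbit_subset_of_reflection_mem (P := P) (S := {μ | μ ≠ 0}) (fun k μ hμ ↦ ?_)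
    (P.ne_zero k) hμ
  simpa using hμ

/-- The weight `lam` is a shortest root, and its orbit consists of all roots of that length. This
matches the extra vertices ᾱ_i with the long chains. -/
theorem IsQuasiMinuscule.root_mem_orbit_iff [Fintype ι] [P.IsCrystallographic] [P.IsReduced]
    [P.IsIrreducible] {lam : M} (h : b.IsQuasiMinuscule lam) (i : b.support) :
    P.root i ∈ orbit P.weylGroup lam ↔ b.IsShort i := by
  obtain ⟨k, rfl, hk⟩ := h.exists_eq_root
  have hmin := rootForm_le_of_coroot'_eq_two_iff h.2.1 hk
  constructor
  · intro hi l
    rw [rootForm_eq_of_mem_orbit hi]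
    exact hmin l
  · intro hi
    exact root_mem_orbit_of_rootForm_eq (le_antisymm (hi k) (hmin i))

end Base

end RootPairing

/-! ### Components of colored digraphs and the diamond lemma -/

namespace EdgeColoredDigraph

section Comp

variable {I V : Type*} {G : EdgeColoredDigraph I V} {J : Set I} {i : I} {x y z : V}

theorem mem_comp_self : x ∈ G.comp J x := Relation.EqvGen.refl x

theorem comp_eq_of_mem (h : y ∈ G.comp J x) : G.comp J y = G.comp J x := by
  ext z
  exact ⟨fun hz ↦ .trans _ _ _ h hz, fun hz ↦ .trans _ _ _ (.symm _ _ h) hz⟩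

theorem mem_comp_of_edge (hi : i ∈ J) (h : G.Edge i x y) : y ∈ G.comp J x :=
  .rel _ _ ⟨i, hi, h⟩

theorem mem_comp_of_edge' (hi : i ∈ J) (h : G.Edge i x y) : x ∈ G.comp J y :=
  .symm _ _ (mem_comp_of_edge hi h)

/-- The induction principle for components: stability is needed in both directions of an edge
because the paths are undirected. -/
theorem comp_subset {S : Set V} (hx : x ∈ S)
    (h : ∀ i ∈ J, ∀ u v, G.Edge i u v → (u ∈ S ↔ v ∈ S)) : G.comp J x ⊆ S := by
  intro y hy
  suffices x ∈ S ↔ y ∈ S from this.mp hx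
  clear hx
  induction hy with
  | rel u v huv => obtain ⟨i, hi, huv⟩ := huv; exact h i hi u v huv
  | refl u => rfl
  | symm u v _ ih => exact ih.symm
  | trans u v w _ _ h1 h2 => exact h1.trans h2

theorem comp_eq_singleton (h : ∀ i ∈ J, ∀ y, ¬ G.Edge i x y ∧ ¬ G.Edge i y x) :
    G.comp J x = {x} := by
  refine Set.Subset.antisymm (comp_subset rfl fun i hi u v huv ↦ ?_)
    (Set.singleton_subset_iff.mpr mem_comp_self)
  simp only [Set.mem_singleton_iff]
  constructor
  · rintro rfl; exact absurd huv (h i hi v).1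
  · rintro rfl; exact absurd huv (h i hi u).2

/-- The `i`-component of `x` is a chain of length at most two. -/
def IsShortString (G : EdgeColoredDigraph I V) (i : I) (x : V) : Prop :=
  G.comp {i} x = {x} ∨ (∃ y, G.Edge i x y ∧ G.comp {i} x = {x, y}) ∨
    (∃ y, G.Edge i y x ∧ G.comp {i} x = {y, x}) ∨
    ∃ x₀ x₁ x₂, G.comp {i} x = {x₀, x₁, x₂} ∧ G.Edge i x₀ x₁ ∧ G.Edge i x₁ x₂

theorem isChain_of_isShortString (h : G.IsShortString i x) :
    IsChain (Relation.ReflTransGen (G.Edge i)) (G.comp {i} x) := by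
  rcases h with h | ⟨y, hy, h⟩ | ⟨y, hy, h⟩ | ⟨x₀, x₁, x₂, h, h01, h12⟩ <;> rw [h]
  · exact Set.subsingleton_singleton.isChain
  · rintro u (rfl | rfl) v (rfl | rfl) huv
    · exact absurd rfl huv
    · exact .inl (.single hy)
    · exact .inr (.single hy)
    · exact absurd rfl huv
  · rintro u (rfl | rfl) v (rfl | rfl) huv
    · exact absurd rfl huv
    · exact .inl (.single hy)
    · exact .inr (.single hy)
    · exact absurd rfl huv
  · have h02 : Relation.ReflTransGen (G.Edge i) x₀ x₂ := .tail (.single h01) h12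
    rintro u (rfl | rfl | rfl) v (rfl | rfl | rfl) huv
    · exact absurd rfl huv
    · exact .inl (.single h01)
    · exact .inl h02
    · exact .inr (.single h01)
    · exact absurd rfl huv
    · exact .inl (.single h12)
    · exact .inr h02
    · exact .inr (.single h12)
    · exact absurd rfl huv

end Comp

section Poset

variable {I R : Type*} [PartialOrder R] {G : EdgeColoredDigraph I R}

theorem exists_isMaximalIn [Finite R] (hG : ∀ i x y, G.Edge i x y → x ⋖ y) (J : Set I) (x : R) :
    ∃ m, x ≤ m ∧ G.IsMaximalIn J x m := by
  induction x using WellFoundedGT.induction with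
  | ind x ih =>
    by_cases h : ∃ i ∈ J, ∃ y, G.Edge i x y
    · obtain ⟨i, hi, y, hxy⟩ := h
      obtain ⟨m, hm, hm', hmax⟩ := ih y (hG i x y hxy).lt
      refine ⟨m, (hG i x y hxy).le.trans hm, ?_, hmax⟩
      rwa [comp_eq_of_mem (mem_comp_of_edge hi hxy)] at hm'
    · push Not at h
      exact ⟨x, le_rfl, mem_comp_self, h⟩

theorem isMax_iff [Finite R] (hG : ∀ i x y, G.Edge i x y → x ⋖ y)
    (hG' : ∀ x y, x ⋖ y → ∃ i, G.Edge i x y) (x : R) : IsMax x ↔ ∀ i y, ¬ G.Edge i x y := by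
  constructor
  · exact fun h i y hxy ↦ h.not_lt (hG i x y hxy).lt
  · intro h
    by_contra hx
    obtain ⟨y, hy⟩ := not_isMax_iff.mp hx
    obtain ⟨z, hz, -⟩ := exists_covBy_le_of_lt hy
    obtain ⟨i, hi⟩ := hG' x z hz
    exact h i z hi

/-- Newman's lemma. Two edges leaving a vertex either coincide or have different colors, and then
lead below the unique maximal element of a two-colored component. So the graph is locally confluent,
and finiteness gives termination. -/
theorem IsConnected.existsUnique_isMax [Finite R] (hG : ∀ i x y, G.Edge i x y → x ⋖ y)
    (hG' : ∀ x y, x ⋖ y → ∃ i, G.Edge i x y) (hconn : G.IsConnected) [Nonempty R]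
    (hinj : ∀ i x y z, G.Edge i x y → G.Edge i x z → y = z)
    (hconf : ∀ i j, i ≠ j → ∀ x y z, G.Edge i x y → G.Edge j x z →
      ∃! m, G.IsMaximalIn {i, j} x m) : ∃ m : R, ∀ x, IsMax x ↔ x = m := by
  have hex (x : R) : ∃ m, x ≤ m ∧ IsMax m := by
    obtain ⟨m, hm, -, hm'⟩ := exists_isMaximalIn hG Set.univ x
    exact ⟨m, hm, (isMax_iff hG hG' m).mpr fun i y ↦ hm' i trivial y⟩
  have key (x : R) : ∀ m m', IsMax m → IsMax m' → x ≤ m → x ≤ m' → m = m' := by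
    induction x using WellFoundedGT.induction with
    | ind x ih =>
      intro m m' hm hm' hxm hxm'
      rcases hxm.eq_or_lt with rfl | hlt
      · exact hm.eq_of_le hxm'
      rcases hxm'.eq_or_lt with rfl | hlt'
      · exact (hm'.eq_of_le hxm).symm
      obtain ⟨y, hxy, hym⟩ := exists_covBy_le_of_lt hlt
      obtain ⟨z, hxz, hzm⟩ := exists_covBy_le_of_lt hlt'
      obtain ⟨i, hi⟩ := hG' x y hxy
      obtain ⟨j, hj⟩ := hG' x z hxz
      by_cases hij : i = j
      · subst hij
        obtain rfl := hinj i x y z hi hj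
        exact ih y hxy.lt m m' hm hm' hym hzm
      obtain ⟨p, hyp, hp⟩ := exists_isMaximalIn hG {i, j} y
      obtain ⟨q, hzq, hq⟩ := exists_isMaximalIn hG {i, j} z
      -- Climbing from `y` and from `z` within their common {i,j}-component ends at the same vertex,
      -- since the maximal element there is unique.
      have hpq : p = q := by
        have hy : y ∈ G.comp {i, j} x := mem_comp_of_edge (by simp) hi
        have hz : z ∈ G.comp {i, j} x := mem_comp_of_edge (by simp) hj
        unfold IsMaximalIn at hp hq
        rw [comp_eq_of_mem hy] at hp
        rw [comp_eq_of_mem hz] at hq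
        exact (hconf i j hij x y z hi hj).unique hp hq
      subst hpq
      obtain ⟨m'', hpm, hm''⟩ := hex p
      rw [ih y hxy.lt m m'' hm hm'' hym (hyp.trans hpm),
        ih z hxz.lt m' m'' hm' hm'' hzm (hzq.trans hpm)]
  obtain ⟨m, -, hm⟩ := hex (Classical.arbitrary R)
  refine ⟨m, fun x ↦ ⟨fun hx ↦ ?_, fun hx ↦ hx ▸ hm⟩⟩
  -- The vertices all of whose maximal upper bounds equal `m` are closed under edges in both
  -- directions, so by connectedness they are all of `R`.
  have hsub := comp_subset (G := G) (J := Set.univ) (x := m)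
    (S := {y | ∀ m', IsMax m' → y ≤ m' → m' = m})
    (fun m' _ h ↦ (hm.eq_of_le h).symm) (fun i _ u v huv ↦ ⟨fun hu m' hm' hvm ↦
      hu m' hm' ((hG i u v huv).le.trans hvm), fun hv m' hm' hum ↦ by
        obtain ⟨m'', hvm, hm''⟩ := hex v
        rw [key u m' m'' hm' hm'' hum ((hG i u v huv).le.trans hvm)]
        exact hv m'' hm'' hvm⟩)
  exact hsub (hconn m x) x hx le_rfl

end Poset

end EdgeColoredDigraph

/-! ### Ranks inside monochromatic components -/

namespace RankFunction

variable {I R : Type*} [PartialOrder R] (ρ : RankFunction R) {G : EdgeColoredDigraph I R}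

theorem rank_lt_of_reflTransGen {i : I} (hG : ∀ i x y, G.Edge i x y → x ⋖ y) {x y : R}
    (h : Relation.ReflTransGen (G.Edge i) x y) (hne : x ≠ y) : ρ.rank x < ρ.rank y := by
  have : x = y ∨ ρ.rank x < ρ.rank y := by
    clear hne
    induction h with
    | refl => exact .inl rfl
    | tail _ h ih =>
      have := ρ.rank_covBy (hG _ _ _ h)
      rcases ih with rfl | ih
      · right; omega
      · right; omega
  exact this.resolve_left hne

/-- Two distinct members of a chain are joined by a directed path, along which the rank strictly
grows. Consequently an edge of given color is determined by either endpoint. -/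
theorem eq_of_mem_comp_of_rank_eq (hG : ∀ i x y, G.Edge i x y → x ⋖ y) (hfib : G.IsFibrous)
    {i : I} {x y z : R} (hy : y ∈ G.comp {i} x) (hz : z ∈ G.comp {i} x)
    (h : ρ.rank y = ρ.rank z) : y = z := by
  by_contra hne
  rcases hfib i x hy hz hne with h' | h'
  · exact (ρ.rank_lt_of_reflTransGen hG h' hne).ne h
  · exact (ρ.rank_lt_of_reflTransGen hG h' (Ne.symm hne)).ne h.symm

theorem edge_right_unique (ρ : RankFunction R) (hG : ∀ i x y, G.Edge i x y → x ⋖ y)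
    (hfib : G.IsFibrous)
    {i : I} {x y z : R} (hy : G.Edge i x y) (hz : G.Edge i x z) : y = z :=
  ρ.eq_of_mem_comp_of_rank_eq hG hfib (EdgeColoredDigraph.mem_comp_of_edge rfl hy)
    (EdgeColoredDigraph.mem_comp_of_edge rfl hz)
    ((ρ.rank_covBy (hG _ _ _ hy)).trans (ρ.rank_covBy (hG _ _ _ hz)).symm)

theorem edge_left_unique (ρ : RankFunction R) (hG : ∀ i x y, G.Edge i x y → x ⋖ y)
    (hfib : G.IsFibrous)
    {i : I} {x y z : R} (hy : G.Edge i y x) (hz : G.Edge i z x) : y = z :=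
  ρ.eq_of_mem_comp_of_rank_eq hG hfib (EdgeColoredDigraph.mem_comp_of_edge' rfl hy)
    (EdgeColoredDigraph.mem_comp_of_edge' rfl hz) (by
      have := ρ.rank_covBy (hG _ _ _ hy)
      have := ρ.rank_covBy (hG _ _ _ hz)
      omega)

variable (G)

/-- For an unbounded set of naturals `sSup` would be the default value 0. -/
theorem bddAbove_rank_image (i : I) (x : R) : BddAbove (ρ.rank '' G.comp {i} x) := by
  refine ⟨ρ.length, ?_⟩
  rintro _ ⟨y, -, rfl⟩
  have : ρ.rank y ∈ Set.range ρ.rank := ⟨y, rfl⟩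
  rw [ρ.range_rank] at this
  exact this

variable {G}

theorem rank_le_sSup {i : I} {x y : R} (h : y ∈ G.comp {i} x) :
    ρ.rank y ≤ sSup (ρ.rank '' G.comp {i} x) :=
  le_csSup (ρ.bddAbove_rank_image G i x) ⟨y, h, rfl⟩

theorem sInf_le_rank {i : I} {x y : R} (h : y ∈ G.comp {i} x) :
    sInf (ρ.rank '' G.comp {i} x) ≤ ρ.rank y :=
  Nat.sInf_le ⟨y, h, rfl⟩

theorem compRank_lt_compLength {i : I} {x y : R} (hG : ∀ i x y, G.Edge i x y → x ⋖ y)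
    (h : G.Edge i x y) : ρ.compRank G i x < ρ.compLength G i x := by
  have h1 := ρ.rank_le_sSup (EdgeColoredDigraph.mem_comp_of_edge (J := {i}) rfl h)
  have h2 := ρ.sInf_le_rank (G := G) (i := i) (x := x) EdgeColoredDigraph.mem_comp_self
  have h3 := ρ.rank_covBy (hG _ _ _ h)
  rw [compRank, compLength]
  omega

theorem compLength_compRank_of_bounds {i : I} {x u v : R} (hu : u ∈ G.comp {i} x)
    (hv : v ∈ G.comp {i} x)
    (h : ∀ w ∈ G.comp {i} x, ρ.rank u ≤ ρ.rank w ∧ ρ.rank w ≤ ρ.rank v) :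
    ρ.compLength G i x = ρ.rank v - ρ.rank u ∧ ρ.compRank G i x = ρ.rank x - ρ.rank u := by
  have h1 : sSup (ρ.rank '' G.comp {i} x) = ρ.rank v := by
    refine IsGreatest.csSup_eq ⟨⟨v, hv, rfl⟩, ?_⟩
    rintro _ ⟨w, hw, rfl⟩
    exact (h w hw).2
  have h2 : sInf (ρ.rank '' G.comp {i} x) = ρ.rank u := by
    refine IsLeast.csInf_eq ⟨⟨u, hu, rfl⟩, ?_⟩
    rintro _ ⟨w, hw, rfl⟩
    exact (h w hw).1
  rw [compLength, compRank, h1, h2]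
  exact ⟨rfl, rfl⟩

theorem compLength_compRank_of_comp_eq_singleton {i : I} {x : R} (h : G.comp {i} x = {x}) :
    ρ.compLength G i x = 0 ∧ ρ.compRank G i x = 0 := by
  have := ρ.compLength_compRank_of_bounds (G := G) (i := i) (x := x) (u := x) (v := x)
    (by simp [h]) (by simp [h]) (by simp [h])
  simpa using this

theorem compLength_compRank_of_comp_eq_pair (hG : ∀ i x y, G.Edge i x y → x ⋖ y) {i : I}
    {u x y : R} (h : G.comp {i} u = {x, y}) (hxy : G.Edge i x y) :
    (ρ.compLength G i x = 1 ∧ ρ.compRank G i x = 0) ∧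
      (ρ.compLength G i y = 1 ∧ ρ.compRank G i y = 1) := by
  have hr := ρ.rank_covBy (hG _ _ _ hxy)
  have hx : G.comp {i} x = {x, y} :=
    (EdgeColoredDigraph.comp_eq_of_mem (by simp [h])).trans h
  have hy : G.comp {i} y = {x, y} :=
    (EdgeColoredDigraph.comp_eq_of_mem (by simp [h])).trans h
  have h1 := ρ.compLength_compRank_of_bounds (G := G) (i := i) (x := x) (u := x) (v := y)
    (by simp [hx]) (by simp [hx]) (by simp [hx, hr])
  have h2 := ρ.compLength_compRank_of_bounds (G := G) (i := i) (x := y) (u := x) (v := y)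
    (by simp [hy]) (by simp [hy]) (by simp [hy, hr])
  omega

theorem compLength_compRank_of_comp_eq_triple (hG : ∀ i x y, G.Edge i x y → x ⋖ y) {i : I}
    {u x y z : R} (h : G.comp {i} u = {x, y, z}) (hxy : G.Edge i x y) (hyz : G.Edge i y z) :
    (ρ.compLength G i x = 2 ∧ ρ.compRank G i x = 0) ∧
      (ρ.compLength G i y = 2 ∧ ρ.compRank G i y = 1) ∧
      (ρ.compLength G i z = 2 ∧ ρ.compRank G i z = 2) := by
  have hr := ρ.rank_covBy (hG _ _ _ hxy)
  have hr' := ρ.rank_covBy (hG _ _ _ hyz)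
  have hw (w : R) (hw : w ∈ G.comp {i} u) :
      ρ.compLength G i w = ρ.rank z - ρ.rank x ∧ ρ.compRank G i w = ρ.rank w - ρ.rank x := by
    have hw' := (EdgeColoredDigraph.comp_eq_of_mem hw).trans h
    refine ρ.compLength_compRank_of_bounds (by simp [hw']) (by simp [hw']) ?_
    rw [hw']
    rintro v (rfl | rfl | rfl) <;> omega
  have hx := hw x (by simp [h])
  have hy := hw y (by simp [h])
  have hz := hw z (by simp [h])
  omega

end RankFunction

theorem RootPairing.Base.coroot'_wt {ι M N : Type*} [AddCommGroup M] [Module ℝ M] [AddCommGroup N]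
    [Module ℝ N] {P : RootPairing ι ℝ M N} [P.IsRootSystem] (b : P.Base) {R : Type*}
    [PartialOrder R] (ρ : RankFunction R) (G : EdgeColoredDigraph b.support R) (i : b.support)
    (x : R) : P.coroot' i (b.wt ρ G x) = ρ.compWeight G i x := by
  classical
  simp only [wt, map_sum, map_zsmul, coroot_fundamentalWeight]
  simp

/-- The simple coroots form a basis of the dual space, so they separate weights. -/
theorem RootPairing.Base.eq_of_forall_coroot'_eq {ι M N : Type*} [AddCommGroup M] [Module ℝ M]
    [AddCommGroup N] [Module ℝ N] {P : RootPairing ι ℝ M N} [P.IsRootSystem] (b : P.Base)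
    {μ ν : M} (h : ∀ i : b.support, P.coroot' i μ = P.coroot' i ν) : μ = ν := by
  apply P.toLinearMap.toPerfPair.injective
  refine b.toCoweightBasis.ext fun i ↦ ?_
  simpa using h i

open EdgeColoredDigraph (mem_comp_self mem_comp_of_edge mem_comp_of_edge' comp_eq_of_mem
  comp_subset comp_eq_singleton)

/-! ### Weights under the local conditions -/

namespace RootPairing.Base

variable {ι M N : Type*} [AddCommGroup M] [Module ℝ M] [AddCommGroup N] [Module ℝ N]
variable {P : RootPairing ι ℝ M N} [P.IsRootSystem] {b : P.Base}

/-- The covering condition is automatic: simple roots are linearly independent, so α_i is not a sum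
of two nonzero nonnegative combinations of them. -/
theorem weightDiagramEdge_iff [Finite ι] {lam : M} {i : b.support} {μ ν : M} :
    b.WeightDiagramEdge lam i μ ν ↔
      μ ∈ b.weightDiagram lam ∧ ν ∈ b.weightDiagram lam ∧ ν = μ + P.root i := by
  classical
  refine ⟨fun h ↦ ⟨h.1, h.2.1, h.2.2.2⟩, ?_⟩
  rintro ⟨hμ, hν, rfl⟩
  refine ⟨hμ, hν, ⟨⟨Pi.single i 1, ?_⟩, by simpa using P.ne_zero (i : ι), ?_⟩, rfl⟩
  · simp [Pi.single_apply]
  · rintro ξ - ⟨k, hk⟩ ⟨l, hl⟩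
    have hsum : ∑ j, (k j + l j) • P.root j = P.root i := by
      simp only [add_smul, Finset.sum_add_distrib, ← hk, ← hl]
      abel
    have hcoord (j : b.support) : (k j + l j : ℝ) = if i = j then 1 else 0 := by
      have := congrArg (fun v ↦ b.toWeightBasis.repr v j) hsum
      simp only [map_sum, map_nsmul, toWeightBasis_repr_root] at this
      simpa [Finsupp.single_apply, Finsupp.finsetSum_apply, Finset.sum_add_distrib] using this
    have hne (j : b.support) (hj : j ≠ i) : k j = 0 := by
      have := hcoord j
      rw [if_neg hj.symm] at this
      have : k j + l j = 0 := by exact_mod_cast this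
      omega
    have hi : k i + l i = 1 := by
      have := hcoord i
      rw [if_pos rfl] at this
      exact_mod_cast this
    rw [Finset.sum_eq_single i (fun j _ hj ↦ by rw [hne j hj, zero_smul]) (by simp)] at hk
    have : k i = 0 ∨ k i = 1 := by omega
    rcases this with h | h <;> rw [h] at hk
    · left
      rwa [zero_smul, sub_eq_zero] at hk
    · right
      rw [one_smul] at hk
      rw [← hk]
      abel

variable {R : Type*} [PartialOrder R]

variable (b) in
/-- The common part of the local characterizations of the minuscule and the quasi-minuscule
splitting posets. -/
structure IsLocallySplitting (ρ : RankFunction R) (G : EdgeColoredDigraph b.support R) : Prop where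
  covBy : ∀ i x y, G.Edge i x y → x ⋖ y
  exists_edge : ∀ x y, x ⋖ y → ∃ i, G.Edge i x y
  isConnected : G.IsConnected
  isFibrous : G.IsFibrous
  isStructured : b.IsStructured ρ G
  nonempty : ∃ i x y, G.Edge i x y
  long : ∀ i x, 2 ≤ ρ.compLength G i x →
    ∃ x₀ x₁ x₂, G.comp {i} x = {x₀, x₁, x₂} ∧ G.Edge i x₀ x₁ ∧ G.Edge i x₁ x₂ ∧
      ∀ j, j ≠ i → ρ.compDepth G j x₀ = 0 ∧ ρ.compRank G j x₂ = 0 ∧ G.comp {j} x₁ = {x₁}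

/-- The element `x` is the middle of a chain `-α_i → x → α_i` of color `i`. -/
def IsMiddle (ρ : RankFunction R) (G : EdgeColoredDigraph b.support R) (i : b.support) (x : R) :
    Prop :=
  ∃ x₀ x₂, G.comp {i} x = {x₀, x, x₂} ∧ G.Edge i x₀ x ∧ G.Edge i x x₂ ∧
    b.wt ρ G x₀ = -P.root i ∧ b.wt ρ G x = 0 ∧ b.wt ρ G x₂ = P.root i ∧
    ∀ j, j ≠ i → ρ.compDepth G j x₀ = 0 ∧ G.comp {j} x = {x}

namespace IsLocallySplitting

variable {ρ : RankFunction R} {G : EdgeColoredDigraph b.support R} (h : b.IsLocallySplitting ρ G)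

include h

theorem wt_eq_of_edge {i : b.support} {x y : R} (hxy : G.Edge i x y) :
    b.wt ρ G y = b.wt ρ G x + P.root i := (h.isStructured i x y hxy).symm

theorem exists_isMiddle_of_long {i : b.support} {x : R} (hx : 2 ≤ ρ.compLength G i x) :
    ∃ y, y ∈ G.comp {i} x ∧ IsMiddle ρ G i y := by
  obtain ⟨x₀, x₁, x₂, hc, h01, h12, hj⟩ := h.long i x hx
  have h1 : x₁ ∈ G.comp {i} x := by simp [hc]
  -- The `i`-coordinate is 2·1 - 2, and the other coordinates vanish because the other components
  -- are points.
  have hw : b.wt ρ G x₁ = 0 := by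
    refine b.eq_of_forall_coroot'_eq fun j ↦ ?_
    rw [coroot'_wt, map_zero, Int.cast_eq_zero, RankFunction.compWeight]
    by_cases hji : j = i
    · subst hji
      have := (ρ.compLength_compRank_of_comp_eq_triple h.covBy hc h01 h12).2.1
      omega
    · have := ρ.compLength_compRank_of_comp_eq_singleton (hj j hji).2.2
      omega
  have hw2 := h.wt_eq_of_edge h12
  have hw0 := h.wt_eq_of_edge h01
  rw [hw, zero_add] at hw2
  rw [hw] at hw0
  refine ⟨x₁, h1, x₀, x₂, (comp_eq_of_mem h1).trans hc, h01, h12, ?_, hw, hw2,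
    fun j hji ↦ ⟨(hj j hji).1, (hj j hji).2.2⟩⟩
  exact (neg_eq_of_add_eq_zero_left hw0.symm).symm

/-- In a component of length at most one, an edge already exhausts the possible ranks, and rank is
injective there. Longer components are described by the hypothesis `long`. -/
theorem classification (i : b.support) (x : R) :
    (G.comp {i} x = {x} ∧ P.coroot' i (b.wt ρ G x) = 0) ∨
    (∃ y, G.Edge i x y ∧ G.comp {i} x = {x, y} ∧ P.coroot' i (b.wt ρ G x) = -1) ∨
    (∃ y, G.Edge i y x ∧ G.comp {i} x = {y, x} ∧ P.coroot' i (b.wt ρ G x) = 1) ∨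
    (∃ x₁, x₁ ∈ G.comp {i} x ∧ IsMiddle ρ G i x₁) := by
  by_cases hl : 2 ≤ ρ.compLength G i x
  · exact .inr (.inr (.inr (h.exists_isMiddle_of_long hl)))
  have hpair (u v : R) (hux : u ∈ G.comp {i} x) (huv : G.Edge i u v) :
      G.comp {i} x = {u, v} := by
    have hvx : v ∈ G.comp {i} x := by
      rw [← comp_eq_of_mem hux]; exact mem_comp_of_edge rfl huv
    refine Set.Subset.antisymm (fun w hw ↦ ?_) (by rintro w (rfl | rfl) <;> assumption)
    have h1 := ρ.rank_covBy (h.covBy i u v huv)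
    have h2 := ρ.sInf_le_rank hux
    have h3 := ρ.rank_le_sSup hvx
    have h4 := ρ.sInf_le_rank hw
    have h5 := ρ.rank_le_sSup hw
    have h6 : ρ.rank w = ρ.rank u ∨ ρ.rank w = ρ.rank v := by
      rw [RankFunction.compLength] at hl
      omega
    rcases h6 with h6 | h6
    · exact .inl (ρ.eq_of_mem_comp_of_rank_eq h.covBy h.isFibrous hw hux h6)
    · exact .inr (ρ.eq_of_mem_comp_of_rank_eq h.covBy h.isFibrous hw hvx h6)
  simp only [coroot'_wt, RankFunction.compWeight]
  by_cases h1 : ∃ y, G.Edge i x y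
  · obtain ⟨y, hy⟩ := h1
    have hc := hpair x y mem_comp_self hy
    refine .inr (.inl ⟨y, hy, hc, ?_⟩)
    have := (ρ.compLength_compRank_of_comp_eq_pair h.covBy hc hy).1
    rw [this.1, this.2]
    norm_num
  by_cases h2 : ∃ y, G.Edge i y x
  · obtain ⟨y, hy⟩ := h2
    have hc := hpair y x (mem_comp_of_edge' rfl hy) hy
    refine .inr (.inr (.inl ⟨y, hy, hc, ?_⟩))
    have := (ρ.compLength_compRank_of_comp_eq_pair h.covBy hc hy).2
    rw [this.1, this.2]
    norm_num
  push Not at h1 h2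
  have hc : G.comp {i} x = {x} := comp_eq_singleton (by rintro _ rfl y; exact ⟨h1 y, h2 y⟩)
  refine .inl ⟨hc, ?_⟩
  have := ρ.compLength_compRank_of_comp_eq_singleton hc
  rw [this.1, this.2]
  norm_num

theorem coroot'_eq_neg_one_or_wt_eq_of_edge {i : b.support} {x y : R} (hxy : G.Edge i x y)
    (hx : b.wt ρ G x ≠ 0) :
    P.coroot' i (b.wt ρ G x) = -1 ∨ b.wt ρ G x = -P.root i := by
  have hy : y ∈ G.comp {i} x := mem_comp_of_edge rfl hxy
  have hlt := (h.covBy i x y hxy).lt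
  rcases h.classification i x with ⟨hc, -⟩ | ⟨-, -, -, hc⟩ | ⟨z, hz, hc, -⟩ | ⟨x₁, hx₁, hm⟩
  · rw [hc] at hy
    exact absurd hy hlt.ne'
  · exact .inl hc
  · rw [hc] at hy
    have hlt' := (h.covBy i z x hz).lt
    rcases hy with rfl | hy
    · exact absurd hlt hlt'.asymm
    · exact absurd hy hlt.ne'
  · obtain ⟨x₀, x₂, hc, h0, h2, hw0, hw1, hw2, -⟩ := hm
    rw [comp_eq_of_mem hx₁] at hc
    have hxc : x ∈ G.comp {i} x := mem_comp_self
    rw [hc] at hxc hy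
    have h0' := (h.covBy _ _ _ h0).lt
    have h2' := (h.covBy _ _ _ h2).lt
    rcases hxc with rfl | rfl | rfl
    · exact .inr hw0
    · exact absurd hw1 hx
    · rcases hy with rfl | rfl | hy
      · exact absurd (h0'.trans h2') hlt.asymm
      · exact absurd h2' hlt.asymm
      · exact absurd hy hlt.ne'

theorem coroot'_mem (i : b.support) (x : R) :
    P.coroot' i (b.wt ρ G x) ∈ ({0, 1, -1, 2, -2} : Set ℝ) ∧
      (P.coroot' i (b.wt ρ G x) = 2 → b.wt ρ G x = P.root i) ∧
      (P.coroot' i (b.wt ρ G x) = -2 → b.wt ρ G x = -P.root i) := by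
  rcases h.classification i x with ⟨-, hc⟩ | ⟨-, -, -, hc⟩ | ⟨-, -, -, hc⟩ | ⟨x₁, hx₁, hm⟩
  · rw [hc]; norm_num
  · rw [hc]; norm_num
  · rw [hc]; norm_num
  · obtain ⟨x₀, x₂, hc, h0, h2, hw0, hw1, hw2, -⟩ := hm
    rw [comp_eq_of_mem hx₁] at hc
    have hxc : x ∈ G.comp {i} x := mem_comp_self
    rw [hc] at hxc
    rcases hxc with rfl | rfl | rfl
    · rw [hw0, map_neg, root_coroot'_eq_pairing, pairing_same]; norm_num
    · rw [hw1, map_zero]; norm_num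
    · rw [hw2, root_coroot'_eq_pairing, pairing_same]; norm_num

theorem exists_isMiddle_of_wt_eq_root {i : b.support} {x : R} (hx : b.wt ρ G x = P.root i) :
    ∃ y, G.Edge i y x ∧ IsMiddle ρ G i y := by
  have h2 : P.coroot' i (b.wt ρ G x) = 2 := by rw [hx, root_coroot'_eq_pairing, pairing_same]
  rcases h.classification i x with ⟨-, hc⟩ | ⟨-, -, -, hc⟩ | ⟨-, -, -, hc⟩ | ⟨x₁, hx₁, hm⟩
  · norm_num [hc] at h2
  · norm_num [hc] at h2
  · norm_num [hc] at h2
  · have hm' := hm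
    obtain ⟨x₀, x₂, hc, h0, h2, hw0, hw1, hw2, -⟩ := hm
    rw [comp_eq_of_mem hx₁] at hc
    have hxc : x ∈ G.comp {i} x := mem_comp_self
    rw [hc] at hxc
    rcases hxc with rfl | rfl | rfl
    · rw [hx] at hw0
      have : IsAddTorsionFree M := .of_isTorsionFree ℝ M
      exact absurd (self_eq_neg.mp hw0) (P.ne_zero _)
    · exact absurd (hx.symm.trans hw1) (P.ne_zero _)
    · exact ⟨x₁, h2, hm'⟩

theorem exists_isMiddle_of_wt_eq_neg_root {i : b.support} {x : R}
    (hx : b.wt ρ G x = -P.root i) : ∃ y, G.Edge i x y ∧ IsMiddle ρ G i y := by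
  have h2 : P.coroot' i (b.wt ρ G x) = -2 := by
    rw [hx, map_neg, root_coroot'_eq_pairing, pairing_same]
  rcases h.classification i x with ⟨-, hc⟩ | ⟨-, -, -, hc⟩ | ⟨-, -, -, hc⟩ | ⟨x₁, hx₁, hm⟩
  · norm_num [hc] at h2
  · norm_num [hc] at h2
  · norm_num [hc] at h2
  · have hm' := hm
    obtain ⟨x₀, x₂, hc, h0, h2, hw0, hw1, hw2, -⟩ := hm
    rw [comp_eq_of_mem hx₁] at hc
    have hxc : x ∈ G.comp {i} x := mem_comp_self
    rw [hc] at hxc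
    rcases hxc with rfl | rfl | rfl
    · exact ⟨x₁, h0, hm'⟩
    · exact absurd (neg_eq_zero.mp (hx.symm.trans hw1)) (P.ne_zero _)
    · rw [hx] at hw2
      have : IsAddTorsionFree M := .of_isTorsionFree ℝ M
      exact absurd (neg_eq_self.mp hw2) (P.ne_zero _)

/-- A vertex of weight zero that is no middle has only trivial components; by connectedness `R`
would be a single point, without edges. -/
theorem exists_isMiddle_of_wt_eq_zero {x : R} (hx : b.wt ρ G x = 0) :
    ∃ i, IsMiddle ρ G i x := by
  by_contra! contra
  have hsing : G.comp Set.univ x = {x} := by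
    refine comp_eq_singleton fun i _ y ↦ ?_
    rcases h.classification i x with ⟨hc, -⟩ | ⟨-, -, -, hc⟩ | ⟨-, -, -, hc⟩ | ⟨x₁, hx₁, hm⟩
    · constructor
      · intro hxy
        have : y ∈ G.comp {i} x := mem_comp_of_edge rfl hxy
        rw [hc] at this
        exact (h.covBy _ _ _ hxy).lt.ne' this
      · intro hxy
        have : y ∈ G.comp {i} x := mem_comp_of_edge' rfl hxy
        rw [hc] at this
        exact (h.covBy _ _ _ hxy).lt.ne this
    · norm_num [hx] at hc
    · norm_num [hx] at hc
    · exfalso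
      have hm' := hm
      obtain ⟨x₀, x₂, hc, h0, h2, hw0, hw1, hw2, -⟩ := hm
      rw [comp_eq_of_mem hx₁] at hc
      have hxc : x ∈ G.comp {i} x := mem_comp_self
      rw [hc] at hxc
      rcases hxc with rfl | rfl | rfl
      · exact P.ne_zero (i : ι) (neg_eq_zero.mp (hw0.symm.trans hx))
      · exact contra i hm'
      · exact P.ne_zero (i : ι) (hw2.symm.trans hx)
  obtain ⟨i, u, v, huv⟩ := h.nonempty
  have hu : u = x := by simpa [hsing] using h.isConnected x u
  have hv : v = x := by simpa [hsing] using h.isConnected x v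
  exact (h.covBy _ _ _ huv).lt.ne (hu.trans hv.symm)

/-- The element of the `i`-component of `x` that is obtained from `x` by the reflection `s_i`. -/
theorem exists_gt_wt_eq_reflection {i : b.support} {x : R} (hx : P.coroot' i (b.wt ρ G x) < 0) :
    ∃ z, x < z ∧ b.wt ρ G z = P.reflection i (b.wt ρ G x) ∧
      ((P.coroot' i (b.wt ρ G x) = -1 ∧ G.Edge i x z) ∨
        (P.coroot' i (b.wt ρ G x) = -2 ∧ ∃ y, G.Edge i x y ∧ G.Edge i y z)) := by
  obtain ⟨h1, -, h2⟩ := h.coroot'_mem i x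
  have h3 : P.coroot' i (b.wt ρ G x) = -1 ∨ P.coroot' i (b.wt ρ G x) = -2 := by
    simp only [Set.mem_insert_iff, Set.mem_singleton_iff] at h1
    rcases h1 with h1 | h1 | h1 | h1 | h1
    · norm_num [h1] at hx
    · norm_num [h1] at hx
    · exact .inl h1
    · norm_num [h1] at hx
    · exact .inr h1
  rcases h3 with h3 | h3
  · rcases h.classification i x with ⟨-, hc⟩ | ⟨z, hz, hc, -⟩ | ⟨-, -, -, hc⟩ | ⟨x₁, hx₁, hm⟩
    · norm_num [hc] at h3
    · refine ⟨z, (h.covBy _ _ _ hz).lt, ?_, .inl ⟨h3, hz⟩⟩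
      rw [h.wt_eq_of_edge hz, reflection_apply, h3, neg_smul, one_smul, sub_neg_eq_add]
    · norm_num [hc] at h3
    · obtain ⟨x₀, x₂, hc, h0, h2, hw0, hw1, hw2, -⟩ := hm
      rw [comp_eq_of_mem hx₁] at hc
      have hxc : x ∈ G.comp {i} x := mem_comp_self
      rw [hc] at hxc
      rcases hxc with rfl | rfl | rfl
      · norm_num [hw0] at h3
      · norm_num [hw1] at h3
      · norm_num [hw2] at h3
  · have hx' := h2 h3
    obtain ⟨y, hxy, x₀, x₂, -, -, hyz, -, -, hw, -⟩ := h.exists_isMiddle_of_wt_eq_neg_root hx'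
    refine ⟨x₂, (h.covBy _ _ _ hxy).lt.trans (h.covBy _ _ _ hyz).lt, ?_, .inr ⟨h3, y, hxy, hyz⟩⟩
    rw [hw, hx', map_neg, reflection_apply_self, neg_neg]

theorem exists_wt_eq_reflection (i : b.support) (x : R) :
    ∃ z, b.wt ρ G z = P.reflection i (b.wt ρ G x) := by
  rcases h.classification i x with ⟨-, hc⟩ | ⟨-, -, -, hc⟩ | ⟨z, hz, -, hc⟩ | ⟨x₁, hx₁, hm⟩
  · exact ⟨x, by rw [reflection_apply, hc, zero_smul, sub_zero]⟩
  · obtain ⟨z, -, hz, -⟩ := h.exists_gt_wt_eq_reflection (i := i) (x := x) (by norm_num [hc])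
    exact ⟨z, hz⟩
  · refine ⟨z, ?_⟩
    rw [reflection_apply, hc, one_smul, h.wt_eq_of_edge hz, add_sub_cancel_right]
  · obtain ⟨x₀, x₂, hc, h0, h2, hw0, hw1, hw2, -⟩ := hm
    rw [comp_eq_of_mem hx₁] at hc
    have hxc : x ∈ G.comp {i} x := mem_comp_self
    rw [hc] at hxc
    rcases hxc with rfl | rfl | rfl
    · exact ⟨x₂, by rw [hw0, hw2, map_neg, reflection_apply_self, neg_neg]⟩
    · exact ⟨x, by rw [hw1, map_zero]⟩
    · exact ⟨x₀, by rw [hw0, hw2, reflection_apply_self]⟩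

theorem isMiddle_color_unique {i j : b.support} {x : R} (hi : IsMiddle ρ G i x)
    (hj : IsMiddle ρ G j x) : i = j := by
  by_contra hij
  obtain ⟨x₀, x₂, -, -, hx, -, -, -, -⟩ := hi
  obtain ⟨y₀, y₂, -, -, -, -, -, -, hd⟩ := hj
  have hc := (hd i hij).2
  have hx2 : x₂ ∈ G.comp {i} x := mem_comp_of_edge rfl hx
  rw [hc] at hx2
  exact (h.covBy _ _ _ hx).lt.ne' hx2

section Confluence

variable [Fintype ι] [P.IsCrystallographic]

/-- If edges of two different colors leave the same vertex, then the corresponding simple roots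
span a root system of type `A₁ × A₁` or `A₂`. -/
theorem cartanMatrix_of_edge_of_edge {i j : b.support} (hij : i ≠ j) {x y z : R}
    (hy : G.Edge i x y) (hz : G.Edge j x z) :
    (b.cartanMatrix i j = 0 ∧ b.cartanMatrix j i = 0) ∨
      (b.cartanMatrix i j = -1 ∧ b.cartanMatrix j i = -1 ∧ 2 ≤ ρ.compLength G j y) := by
  -- A vertex of weight zero is a middle, and only one color occurs at a middle.
  have hx0 : b.wt ρ G x ≠ 0 := by
    intro hx
    obtain ⟨k, hk⟩ := h.exists_isMiddle_of_wt_eq_zero hx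
    have hik (l : b.support) (w : R) (hw : G.Edge l x w) : l = k := by
      by_contra hne
      obtain ⟨y₀, y₂, -, -, -, -, -, -, hd⟩ := hk
      have hw' : w ∈ G.comp {l} x := mem_comp_of_edge rfl hw
      rw [(hd l hne).2] at hw'
      exact (h.covBy _ _ _ hw).lt.ne' hw'
    exact hij ((hik i y hy).trans (hik j z hz).symm)
  -- The alternative is that `x` is the bottom of a long `k`-chain. There the depth in every other
  -- color is 0, so no edge of color `l` could leave.
  have hone (k l : b.support) (hkl : l ≠ k) (u v : R) (hu : G.Edge k x u) (hv : G.Edge l x v) :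
      P.coroot' k (b.wt ρ G x) = -1 := by
    refine (h.coroot'_eq_neg_one_or_wt_eq_of_edge hu hx0).resolve_right fun hw ↦ ?_
    obtain ⟨w, hxw, x₀, x₂, -, h0, -, -, -, -, hd⟩ := h.exists_isMiddle_of_wt_eq_neg_root hw
    obtain rfl := ρ.edge_left_unique h.covBy h.isFibrous hxw h0
    have h1 := (hd l hkl).1
    have h2 := ρ.compRank_lt_compLength h.covBy hv
    rw [RankFunction.compDepth] at h1
    omega
  have hi := hone i j hij.symm y z hy hz
  have hj := hone j i hij z y hz hy
  -- The pairing with α_l^∨ at `u` is -1 + ⟨α_k, α_l^∨⟩, which is at least -2. Equality means 2ρ_l -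
  -- l_l = -2, so the `l`-component of `u` is long.
  have hcart (k l : b.support) (u : R) (hu : G.Edge k x u)
      (hl : P.coroot' l (b.wt ρ G x) = -1) : -1 ≤ b.cartanMatrix k l ∧
      (b.cartanMatrix k l = -1 → 2 ≤ ρ.compLength G l u) := by
    have h1 := (h.coroot'_mem l u).1
    have h2 := b.coroot'_wt ρ G l u
    have h3 : ((b.cartanMatrix k l : ℤ) : ℝ) = P.pairing k l :=
      b.algebraMap_cartanMatrixIn_apply ℤ k l
    have h4 : P.coroot' l (b.wt ρ G u) = -1 + P.pairing k l := by
      rw [h.wt_eq_of_edge hu, map_add, hl, root_coroot'_eq_pairing]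
    have h5 : (-1 : ℝ) ≤ (b.cartanMatrix k l : ℤ) := by
      rw [h3]
      simp only [Set.mem_insert_iff, Set.mem_singleton_iff] at h1
      grind
    refine ⟨by exact_mod_cast h5, fun h6 ↦ ?_⟩
    rw [h6] at h3
    rw [h4, ← h3, RankFunction.compWeight] at h2
    have h7 : -1 + -1 = 2 * (ρ.compRank G l u : ℤ) - (ρ.compLength G l u : ℤ) := by
      exact_mod_cast h2
    omega
  have h1 := hcart i j y hy hj
  have h2 := hcart j i z hz hi
  have h3 := b.cartanMatrix_le_zero_of_ne i j hij
  have h4 := b.cartanMatrix_le_zero_of_ne j i hij.symm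
  have h5 := b.cartanMatrix_apply_eq_zero_iff_symm (i := i) (j := j)
  by_cases h6 : b.cartanMatrix i j = 0
  · exact .inl ⟨h6, h5.mp h6⟩
  · have h7 : b.cartanMatrix j i ≠ 0 := fun h ↦ h6 (h5.mpr h)
    have h8 : b.cartanMatrix i j = -1 := by omega
    exact .inr ⟨h8, by omega, h1.2 h8⟩

end Confluence

section Maximum

variable {m : R} (hm : ∀ x, IsMax x ↔ x = m)

include hm

theorem wt_max_ne_zero : b.wt ρ G m ≠ 0 := by
  intro h0
  obtain ⟨i, -, x₂, -, -, hx, -⟩ := h.exists_isMiddle_of_wt_eq_zero h0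
  exact ((hm m).mpr rfl).not_lt (h.covBy _ _ _ hx).lt

theorem coroot'_max_nonneg (i : b.support) : 0 ≤ P.coroot' i (b.wt ρ G m) := by
  by_contra! hneg
  obtain ⟨z, hz, -⟩ := h.exists_gt_wt_eq_reflection hneg
  exact ((hm m).mpr rfl).not_lt hz

theorem isDominant_wt_max : b.IsDominant (b.wt ρ G m) := by
  refine ⟨fun i ↦ (ρ.compWeight G i m).toNat, Finset.sum_congr rfl fun i _ ↦ ?_⟩
  have h1 := h.coroot'_max_nonneg hm i
  rw [coroot'_wt] at h1
  have h2 : 0 ≤ ρ.compWeight G i m := by exact_mod_cast h1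
  rw [← natCast_zsmul, Int.toNat_of_nonneg h2]

variable [Finite R]

theorem exists_coroot'_neg {x : R} (hx : b.wt ρ G x ≠ 0) (hxm : x ≠ m) :
    ∃ i : b.support, P.coroot' i (b.wt ρ G x) < 0 := by
  rw [Ne, ← hm, EdgeColoredDigraph.isMax_iff h.covBy h.exists_edge] at hxm
  push Not at hxm
  obtain ⟨i, y, hxy⟩ := hxm
  refine ⟨i, ?_⟩
  rcases h.coroot'_eq_neg_one_or_wt_eq_of_edge hxy hx with hc | hc
  · norm_num [hc]
  · norm_num [hc]

/-- Downward induction: reflect both vertices upwards by the same s_i, identify the images, and come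
back along edges, which are determined by their upper ends. -/
theorem eq_of_wt_eq {x y : R} (hxy : b.wt ρ G x = b.wt ρ G y) (hx : b.wt ρ G x ≠ 0) : x = y := by
  induction x using WellFoundedGT.induction generalizing y with
  | ind x ih =>
    -- Any other vertex of nonzero weight has a negative simple pairing, whereas wt(m) is dominant.
    have hmax (u v : R) (hu : u = m) (huv : b.wt ρ G u = b.wt ρ G v) (hu0 : b.wt ρ G u ≠ 0) :
        v = m := by
      by_contra hv
      obtain ⟨i, hi⟩ := h.exists_coroot'_neg hm (huv ▸ hu0) hv
      rw [← huv, hu] at hi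
      exact (h.coroot'_max_nonneg hm i).not_gt hi
    by_cases hxm : x = m
    · exact hxm.trans (hmax x y hxm hxy hx).symm
    obtain ⟨i, hi⟩ := h.exists_coroot'_neg hm hx hxm
    obtain ⟨u, hu, hwu, hcu⟩ := h.exists_gt_wt_eq_reflection hi
    obtain ⟨v, hv, hwv, hcv⟩ := h.exists_gt_wt_eq_reflection (hxy ▸ hi)
    obtain rfl : u = v := ih u hu (by rw [hwu, hwv, hxy]) (by rw [hwu]; simpa using hx)
    rw [← hxy] at hcv
    rcases hcu with ⟨hc, hcu⟩ | ⟨hc, w, hxw, hwu⟩ <;>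
      rcases hcv with ⟨hc', hcv⟩ | ⟨hc', w', hyw', hwv'⟩
    · exact ρ.edge_left_unique h.covBy h.isFibrous hcu hcv
    · norm_num [hc] at hc'
    · norm_num [hc] at hc'
    · obtain rfl := ρ.edge_left_unique h.covBy h.isFibrous hwu hwv'
      exact ρ.edge_left_unique h.covBy h.isFibrous hxw hyw'

theorem wt_mem_orbit {x : R} (hx : b.wt ρ G x ≠ 0) :
    b.wt ρ G x ∈ orbit P.weylGroup (b.wt ρ G m) := by
  induction x using WellFoundedGT.induction with
  | ind x ih =>
    by_cases hxm : x = m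
    · rw [hxm]; exact MulAction.mem_orbit_self _
    obtain ⟨i, hi⟩ := h.exists_coroot'_neg hm hx hxm
    obtain ⟨u, hu, hwu, -⟩ := h.exists_gt_wt_eq_reflection hi
    have := reflection_mem_orbit (P := P) (i : ι) (ih u hu (by rw [hwu]; simpa using hx))
    simpa [hwu] using this

/-- The nonzero weights of vertices are stable under simple reflections, hence under all
reflections, and each of them reflects up to wt(m). -/
theorem mem_orbit_iff [Finite ι] [P.IsCrystallographic] [P.IsReduced] {μ : M} :
    μ ∈ orbit P.weylGroup (b.wt ρ G m) ↔ μ ≠ 0 ∧ ∃ x, b.wt ρ G x = μ := by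
  constructor
  · refine fun hμ ↦ orbit_subset_of_reflection_mem (P := P)
      (S := {μ | μ ≠ 0 ∧ ∃ x, b.wt ρ G x = μ}) (b.forall_reflection_mem ?_)
      ⟨h.wt_max_ne_zero hm, m, rfl⟩ hμ
    rintro i hi _ ⟨h0, x, rfl⟩
    exact ⟨by simpa using h0, h.exists_wt_eq_reflection ⟨i, hi⟩ x⟩
  · rintro ⟨h0, x, rfl⟩
    exact h.wt_mem_orbit hm h0

theorem edge_iff_wt_eq {i : b.support} {x y : R} (hx : b.wt ρ G x ≠ 0) (hy : b.wt ρ G y ≠ 0) :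
    G.Edge i x y ↔ b.wt ρ G y = b.wt ρ G x + P.root i := by
  refine ⟨h.wt_eq_of_edge, fun hxy ↦ ?_⟩
  have hc : P.coroot' i (b.wt ρ G y) = P.coroot' i (b.wt ρ G x) + 2 := by
    rw [hxy, map_add, root_coroot'_eq_pairing, pairing_same]
  have h1 := h.coroot'_mem i x
  have h2 := h.coroot'_mem i y
  -- The pairings c at `x` and c + 2 at `y` both lie in [-2,2]. If c = 0, then wt(y) = α_i and wt(x)
  -- = 0; if c = -2, then wt(x) = -α_i and wt(y) = 0. So c = -1, and the upward reflection of `x` is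
  -- a single edge ending at the weight of `y`.
  have h3 : P.coroot' i (b.wt ρ G x) ≠ 0 := by
    intro h0
    have := h2.2.1 (by rw [hc, h0, zero_add])
    rw [hxy, add_eq_right] at this
    exact hx this
  have h4 : P.coroot' i (b.wt ρ G x) ≠ -2 := by
    intro h0
    apply hy
    rw [hxy, h1.2.2 h0, neg_add_cancel]
  have h5 : P.coroot' i (b.wt ρ G x) = -1 := by
    have h1' := h1.1
    have h2' := h2.1
    rw [hc] at h2'
    simp only [Set.mem_insert_iff, Set.mem_singleton_iff] at h1' h2'
    grind
  obtain ⟨z, hz, hwz, hcz⟩ := h.exists_gt_wt_eq_reflection (i := i) (x := x) (by norm_num [h5])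
  rw [reflection_apply, h5, neg_smul, one_smul, sub_neg_eq_add, ← hxy] at hwz
  obtain rfl := h.eq_of_wt_eq hm hwz.symm hy
  rcases hcz with ⟨-, hcz⟩ | ⟨hcz, -⟩
  · exact hcz
  · exact absurd hcz h4

end Maximum

end IsLocallySplitting

theorem wt_mem_weightLattice (ρ : RankFunction R) (G : EdgeColoredDigraph b.support R) (x : R) :
    b.wt ρ G x ∈ b.weightLattice :=
  AddSubgroup.sum_mem _ fun i _ ↦ AddSubgroup.zsmul_mem _
    (AddSubgroup.subset_closure (Set.mem_range_self i)) _

end RootPairing.Base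

/-! ### Recovering the splitting posets from the local conditions -/

namespace RootPairing.Base

variable {ι M N : Type*} [AddCommGroup M] [Module ℝ M] [AddCommGroup N] [Module ℝ N]
variable {P : RootPairing ι ℝ M N} [P.IsRootSystem] {b : P.Base}
variable {R : Type*} [PartialOrder R]

namespace IsLocallySplitting

variable {ρ : RankFunction R} {G : EdgeColoredDigraph b.support R} (h : b.IsLocallySplitting ρ G)

include h

theorem existsUnique_isMax [Finite R]
    (hconf : ∀ i j, i ≠ j → ∀ x y z, G.Edge i x y → G.Edge j x z →
      ∃! m, G.IsMaximalIn {i, j} x m) : ∃ m : R, ∀ x, IsMax x ↔ x = m := by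
  have : Nonempty R := by
    obtain ⟨-, x, -, -⟩ := h.nonempty
    exact ⟨x⟩
  exact h.isConnected.existsUnique_isMax h.covBy h.exists_edge
    (fun i x y z ↦ ρ.edge_right_unique h.covBy h.isFibrous) hconf

theorem compLength_eq_two_of_isMiddle {i : b.support} {x : R} (hx : IsMiddle ρ G i x) :
    ρ.compLength G i x = 2 := by
  obtain ⟨x₀, x₂, hc, h0, h2, -⟩ := hx
  exact (ρ.compLength_compRank_of_comp_eq_triple h.covBy hc h0 h2).2.1.1

/-- Without long chains there are no middles, hence no vertices of weight zero, and the weight map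
itself is the isomorphism. The A₂ alternative at a fork would create a long chain, so only
orthogonal colors need confluence. -/
theorem exists_max_minuscule [Finite R] [Fintype ι] [P.IsCrystallographic] [P.IsReduced]
    (hl : ∀ i x, ρ.compLength G i x ≤ 1)
    (horth : ∀ i j, b.cartanMatrix i j = 0 → b.cartanMatrix j i = 0 →
      ∀ x, ∃! m, G.IsMaximalIn {i, j} x m) :
    ∃ m : R, (∀ x, IsMax x ↔ x = m) ∧ b.IsDominant (b.wt ρ G m) ∧ b.IsMinuscule (b.wt ρ G m) ∧
      G.Isomorphic (b.minusculePoset (b.wt ρ G m)) := by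
  obtain ⟨m, hm⟩ := h.existsUnique_isMax fun i j hij x y z hy hz ↦ by
    rcases h.cartanMatrix_of_edge_of_edge hij hy hz with hc | ⟨-, -, hc⟩
    · exact horth i j hc.1 hc.2 x
    · exact absurd (hc.trans (hl j y)) (by norm_num)
  have hmid (i : b.support) (x : R) : ¬ IsMiddle ρ G i x := by
    intro hx
    have h1 := h.compLength_eq_two_of_isMiddle hx
    have h2 := hl i x
    omega
  have hne (x : R) : b.wt ρ G x ≠ 0 := by
    intro hx
    obtain ⟨i, hi⟩ := h.exists_isMiddle_of_wt_eq_zero hx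
    exact hmid i x hi
  have hdom := h.isDominant_wt_max hm
  have hmin : b.IsMinuscule (b.wt ρ G m) := by
    refine ⟨wt_mem_weightLattice ρ G m, hne m, fun k ↦ ?_⟩
    obtain ⟨i, hi, ν, hν, hkν, -⟩ := b.exists_simple_coroot'_eq
      (S := orbit P.weylGroup (b.wt ρ G m)) (fun i _ μ hμ ↦ reflection_mem_orbit i hμ) k _
      (MulAction.mem_orbit_self _)
    obtain ⟨-, x, rfl⟩ := (h.mem_orbit_iff hm).mp hν
    rw [hkν]
    rcases h.classification ⟨i, hi⟩ x with
      ⟨-, hc⟩ | ⟨-, -, -, hc⟩ | ⟨-, -, -, hc⟩ | ⟨x₁, -, hx₁⟩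
    · simp only at hc; rw [hc]; norm_num
    · simp only at hc; rw [hc]; norm_num
    · simp only at hc; rw [hc]; norm_num
    · exact absurd hx₁ (hmid _ _)
  have hdiag := hmin.weightDiagram_eq hdom
  have hmem (x : R) : b.wt ρ G x ∈ b.weightDiagram (b.wt ρ G m) := by
    rw [hdiag, h.mem_orbit_iff hm]
    exact ⟨hne x, x, rfl⟩
  refine ⟨m, hm, hdom, hmin, Equiv.ofBijective (fun x ↦ ⟨b.wt ρ G x, hmem x⟩) ⟨?_, ?_⟩, ?_⟩
  · intro x y hxy
    exact h.eq_of_wt_eq hm (congrArg Subtype.val hxy) (hne x)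
  · rintro ⟨μ, hμ⟩
    rw [hdiag, h.mem_orbit_iff hm] at hμ
    obtain ⟨-, x, rfl⟩ := hμ
    exact ⟨x, rfl⟩
  · intro i x y
    rw [h.edge_iff_wt_eq hm (hne x) (hne y)]
    change _ ↔ b.WeightDiagramEdge _ i (b.wt ρ G x) (b.wt ρ G y)
    rw [weightDiagramEdge_iff]
    exact ⟨fun hxy ↦ ⟨hmem x, hmem y, hxy⟩, fun hxy ↦ hxy.2.2⟩

/-- The top of a long chain has weight α_i, so wt(m) is conjugate to a root and is a root. The value
2 at a coroot forces wt(m) to be the corresponding root, which gives uniqueness. -/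
theorem isQuasiMinuscule_wt_max [Finite R] [Finite ι] [P.IsCrystallographic] [P.IsReduced] {m : R}
    (hm : ∀ x, IsMax x ↔ x = m) {i : b.support} {x : R} (hx : IsMiddle ρ G i x) :
    b.IsQuasiMinuscule (b.wt ρ G m) := by
  have key (k : ι) : P.coroot' k (b.wt ρ G m) ∈ ({0, 1, -1, 2, -2} : Set ℝ) ∧
      (P.coroot' k (b.wt ρ G m) = 2 → b.wt ρ G m = P.root k) := by
    obtain ⟨i, hi, ν, hν, hkν, hiff⟩ := b.exists_simple_coroot'_eq
      (S := orbit P.weylGroup (b.wt ρ G m)) (fun i _ μ hμ ↦ reflection_mem_orbit i hμ) k _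
      (MulAction.mem_orbit_self _)
    obtain ⟨-, x, rfl⟩ := (h.mem_orbit_iff hm).mp hν
    rw [hkν, hiff]
    obtain ⟨h1, h2, -⟩ := h.coroot'_mem ⟨i, hi⟩ x
    exact ⟨h1, h2⟩
  have hroot : ∃ k, b.wt ρ G m = P.root k := by
    obtain ⟨-, x₂, -, -, -, -, -, hw, -⟩ := hx
    have h1 : P.root i ∈ orbit P.weylGroup (b.wt ρ G m) := by
      rw [h.mem_orbit_iff hm]
      exact ⟨P.ne_zero _, x₂, hw⟩
    obtain ⟨g, hg⟩ := MulAction.mem_orbit_symm.mp h1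
    exact ⟨P.weylGroupToPerm g i, by rw [← weylGroup_apply_root]; exact hg.symm⟩
  obtain ⟨k, hk⟩ := hroot
  refine ⟨wt_mem_weightLattice ρ G m, fun k ↦ (key k).1, k, ?_, fun l hl ↦ ?_⟩
  · simp only [hk, root_coroot'_eq_pairing, pairing_same]
  · exact P.root.injective (((key l).2 hl).symm.trans hk)

theorem exists_max_quasiMinuscule [Finite R] [Fintype ι] [P.IsCrystallographic] [P.IsReduced]
    [P.IsIrreducible] (hl : ∃ i x, 2 ≤ ρ.compLength G i x)
    (horth : ∀ i j, b.cartanMatrix i j = 0 → b.cartanMatrix j i = 0 →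
      ∀ x, ∃! m, G.IsMaximalIn {i, j} x m)
    (hA₂ : ∀ i j, b.cartanMatrix i j = -1 → b.cartanMatrix j i = -1 →
      ∀ x, ∃! m, G.IsMaximalIn {i, j} x m) :
    ∃ m : R, (∀ x, IsMax x ↔ x = m) ∧
      b.IsDominant (b.wt ρ G m) ∧ b.IsQuasiMinuscule (b.wt ρ G m) ∧
      G.Isomorphic (b.quasiMinusculePoset (b.wt ρ G m)) := by
  obtain ⟨m, hm⟩ := h.existsUnique_isMax fun i j hij x y z hy hz ↦ by
    rcases h.cartanMatrix_of_edge_of_edge hij hy hz with hc | ⟨hc, hc', -⟩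
    · exact horth i j hc.1 hc.2 x
    · exact hA₂ i j hc hc' x
  have hdom := h.isDominant_wt_max hm
  have hqm : b.IsQuasiMinuscule (b.wt ρ G m) := by
    obtain ⟨i, x, hx⟩ := hl
    obtain ⟨y, -, hy⟩ := h.exists_isMiddle_of_long hx
    exact h.isQuasiMinuscule_wt_max hm hy
  refine ⟨m, hm, hdom, hqm, ?_⟩
  set lam := b.wt ρ G m with hlam
  -- A correspondence, shown below to be the graph of a bijection: vertices of nonzero weight go to
  -- their weights, middles to the color of their chain.
  let F (x : R) : orbit P.weylGroup lam ⊕ {i : b.support // b.IsShort i} → Prop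
    | .inl μ => b.wt ρ G x = μ
    | .inr j => IsMiddle ρ G j x
  have hne0 (μ : orbit P.weylGroup lam) : (μ : M) ≠ 0 := hqm.ne_zero_of_mem_orbit μ.2
  have hex (x : R) : ∃ v, F x v := by
    by_cases hx : b.wt ρ G x = 0
    · obtain ⟨i, hi⟩ := h.exists_isMiddle_of_wt_eq_zero hx
      have hi' := hi
      obtain ⟨-, x₂, -, -, -, -, -, hw, -⟩ := hi
      have hs : b.IsShort i := by
        rw [← hqm.root_mem_orbit_iff, h.mem_orbit_iff hm]
        exact ⟨P.ne_zero _, x₂, hw⟩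
      exact ⟨.inr ⟨i, hs⟩, hi'⟩
    · exact ⟨.inl ⟨b.wt ρ G x, h.wt_mem_orbit hm hx⟩, rfl⟩
  choose f hf using hex
  have hmid0 {i : b.support} {x : R} (hx : IsMiddle ρ G i x) : b.wt ρ G x = 0 := by
    obtain ⟨x₀, x₂, -, -, -, -, hw, -⟩ := hx
    exact hw
  -- The tops of both chains have the nonzero weight α_i, so they coincide, and so do the vertices
  -- just below.
  have hmid_unique {i : b.support} {x y : R} (hx : IsMiddle ρ G i x) (hy : IsMiddle ρ G i y) :
      x = y := by
    obtain ⟨x₀, x₂, -, -, hx, -, -, hwx, -⟩ := hx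
    obtain ⟨y₀, y₂, -, -, hy, -, -, hwy, -⟩ := hy
    obtain rfl := h.eq_of_wt_eq hm (hwx.trans hwy.symm) (by rw [hwx]; exact P.ne_zero _)
    exact ρ.edge_left_unique h.covBy h.isFibrous hx hy
  have hF_fun {x : R} {v w} (hv : F x v) (hw : F x w) : v = w := by
    rcases v with μ | j <;> rcases w with ν | k
    · exact congrArg Sum.inl (Subtype.ext (hv.symm.trans hw))
    · exact absurd (hv.symm.trans (hmid0 hw)) (hne0 μ)
    · exact absurd (hw.symm.trans (hmid0 hv)) (hne0 ν)
    · exact congrArg Sum.inr (Subtype.ext (h.isMiddle_color_unique hv hw))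
  have hF_inj {x y : R} {v} (hx : F x v) (hy : F y v) : x = y := by
    rcases v with μ | j
    · have hx' : b.wt ρ G x = μ := hx
      exact h.eq_of_wt_eq hm (hx'.trans (Eq.symm hy)) (hx' ▸ hne0 μ)
    · exact hmid_unique hx hy
  have hF_surj (v) : ∃ x, F x v := by
    rcases v with ⟨μ, hμ⟩ | ⟨j, hj⟩
    · exact ((h.mem_orbit_iff hm).mp hμ).2
    · rw [← hqm.root_mem_orbit_iff, h.mem_orbit_iff hm] at hj
      obtain ⟨-, x, hx⟩ := hj
      obtain ⟨y, -, hy⟩ := h.exists_isMiddle_of_wt_eq_root hx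
      exact ⟨y, hy⟩
  have hedge (i : b.support) (x y : R) (v w) (hv : F x v) (hw : F y w) :
      G.Edge i x y ↔ (b.quasiMinusculePoset lam).Edge i v w := by
    rcases v with ⟨μ, hμ⟩ | ⟨j, hj⟩ <;> rcases w with ⟨ν, hν⟩ | ⟨k, hk⟩
    · change _ ↔ b.WeightDiagramEdge _ i μ ν
      have hx : b.wt ρ G x = μ := hv
      have hy : b.wt ρ G y = ν := hw
      rw [weightDiagramEdge_iff, h.edge_iff_wt_eq hm (by rw [hx]; exact hne0 ⟨μ, hμ⟩)
        (by rw [hy]; exact hne0 ⟨ν, hν⟩), hx, hy]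
      exact ⟨fun hxy ↦ ⟨hdom.orbit_subset_weightDiagram hμ, hdom.orbit_subset_weightDiagram hν,
        hxy⟩, fun hxy ↦ hxy.2.2⟩
    · change _ ↔ k = i ∧ μ = -P.root i
      have hx : b.wt ρ G x = μ := hv
      have hy : IsMiddle ρ G k y := hw
      constructor
      · intro hxy
        have hxw := h.wt_eq_of_edge hxy
        rw [hmid0 hy, hx] at hxw
        have hμi := (neg_eq_of_add_eq_zero_left hxw.symm).symm
        obtain ⟨z, hz, hz'⟩ := h.exists_isMiddle_of_wt_eq_neg_root (hx.trans hμi)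
        obtain rfl := ρ.edge_right_unique h.covBy h.isFibrous hxy hz
        exact ⟨h.isMiddle_color_unique hy hz', hμi⟩
      · rintro ⟨rfl, hμi⟩
        obtain ⟨z, hz, hz'⟩ := h.exists_isMiddle_of_wt_eq_neg_root (hx.trans hμi)
        rwa [hmid_unique hy hz']
    · change _ ↔ j = i ∧ ν = P.root i
      have hx : IsMiddle ρ G j x := hv
      have hy : b.wt ρ G y = ν := hw
      constructor
      · intro hxy
        have hxw := h.wt_eq_of_edge hxy
        rw [hmid0 hx, hy, zero_add] at hxw
        obtain ⟨z, hz, hz'⟩ := h.exists_isMiddle_of_wt_eq_root (hy.trans hxw)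
        obtain rfl := ρ.edge_left_unique h.covBy h.isFibrous hxy hz
        exact ⟨h.isMiddle_color_unique hx hz', hxw⟩
      · rintro ⟨rfl, hνi⟩
        obtain ⟨z, hz, hz'⟩ := h.exists_isMiddle_of_wt_eq_root (hy.trans hνi)
        rwa [hmid_unique hx hz']
    · change _ ↔ False
      refine iff_false_intro fun hxy ↦ ?_
      have hxw := h.wt_eq_of_edge hxy
      rw [hmid0 hv, hmid0 hw, zero_add] at hxw
      exact P.ne_zero _ hxw.symm
  refine ⟨Equiv.ofBijective f ⟨fun x y hxy ↦ ?_, fun v ↦ ?_⟩, fun i x y ↦ ?_⟩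
  · exact hF_inj (hf x) (hxy ▸ hf y)
  · obtain ⟨x, hx⟩ := hF_surj v
    exact ⟨x, hF_fun (hf x) hx⟩
  · exact hedge i x y _ _ (hf x) (hf y)

end IsLocallySplitting

end RootPairing.Base

/-! ### Weight models and the local conditions -/

namespace EdgeColoredDigraph

variable {I V : Type*} {G : EdgeColoredDigraph I V} {i : I} {x y z : V}

theorem comp_mono {J K : Set I} (h : J ⊆ K) : G.comp J x ⊆ G.comp K x :=
  comp_subset mem_comp_self fun _ hi _ _ huv ↦
    ⟨fun hu ↦ comp_eq_of_mem hu ▸ mem_comp_of_edge (h hi) huv,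
      fun hv ↦ comp_eq_of_mem hv ▸ mem_comp_of_edge' (h hi) huv⟩

theorem comp_eq_pair (hxy : G.Edge i x y) (hx : ∀ z, G.Edge i x z → z = y)
    (hy : ∀ z, G.Edge i z y → z = x) (hx' : ∀ z, ¬ G.Edge i z x) (hy' : ∀ z, ¬ G.Edge i y z) :
    G.comp {i} x = {x, y} := by
  refine Set.Subset.antisymm (comp_subset (by simp) ?_) ?_
  · rintro _ rfl u v huv
    constructor
    · rintro (rfl | rfl)
      · exact .inr (hx v huv)
      · exact absurd huv (hy' v)
    · rintro (rfl | rfl)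
      · exact absurd huv (hx' u)
      · exact .inl (hy u huv)
  · rintro w (rfl | rfl)
    · exact mem_comp_self
    · exact mem_comp_of_edge rfl hxy

theorem comp_eq_triple (hxy : G.Edge i x y) (hyz : G.Edge i y z)
    (hx : ∀ u, G.Edge i x u → u = y) (hy : ∀ u, G.Edge i u y → u = x)
    (hy' : ∀ u, G.Edge i y u → u = z) (hz : ∀ u, G.Edge i u z → u = y)
    (hx' : ∀ u, ¬ G.Edge i u x) (hz' : ∀ u, ¬ G.Edge i z u) :
    G.comp {i} x = {x, y, z} := by
  have hyc : y ∈ G.comp {i} x := mem_comp_of_edge rfl hxy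
  refine Set.Subset.antisymm (comp_subset (by simp) ?_) ?_
  · rintro _ rfl u v huv
    constructor
    · rintro (rfl | rfl | rfl)
      · exact .inr (.inl (hx v huv))
      · exact .inr (.inr (hy' v huv))
      · exact absurd huv (hz' v)
    · rintro (rfl | rfl | rfl)
      · exact absurd huv (hx' u)
      · exact .inl (hy u huv)
      · exact .inr (.inl (hz u huv))
  · rintro w (rfl | rfl | rfl)
    · exact mem_comp_self
    · exact hyc
    · exact comp_eq_of_mem hyc ▸ mem_comp_of_edge rfl hyz

end EdgeColoredDigraph

namespace RootPairing.Base

variable {ι M N : Type*} [AddCommGroup M] [Module ℝ M] [AddCommGroup N] [Module ℝ N]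
variable {P : RootPairing ι ℝ M N} {b : P.Base}
variable {R : Type*}

/-- An assignment `w` of weights to the vertices of a colored digraph that makes its monochromatic
components the root strings of a minuscule or quasi-minuscule splitting poset. The map `f` modifies
`w` at the vertices of weight zero, so that it becomes equivariant up to stabilization. -/
structure IsWeightModel (G : EdgeColoredDigraph b.support R) (lam : M) (w f : R → M) : Prop where
  wt_edge : ∀ i x y, G.Edge i x y → w y = w x + P.root i
  edge : ∀ i x y, G.Edge i x y → f y = P.reflection i (f x) ∨ f y = f x
  eq_of_ne_zero : ∀ x, w x ≠ 0 → f x = w x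
  injective : ∀ x y, w x = w y → w x ≠ 0 → x = y
  mem_orbit : ∀ x, w x ≠ 0 → w x ∈ orbit P.weylGroup lam
  exists_eq : ∃ x, w x = lam
  ne_zero : lam ≠ 0
  middle : ∀ x, w x = 0 → ∃ k, (∃ y, G.Edge k x y) ∧ ∀ j, j ≠ k → G.comp {j} x = {x}
  string : ∀ (i : b.support) (x : R),
    (G.comp {i} x = {x} ∧ P.coroot' i (w x) = 0) ∨
    (∃ y, G.Edge i x y ∧ G.comp {i} x = {x, y} ∧ P.coroot' i (w x) = -1) ∨
    (∃ y, G.Edge i y x ∧ G.comp {i} x = {y, x} ∧ P.coroot' i (w x) = 1) ∨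
    (∃ x₀ x₁ x₂, G.comp {i} x = {x₀, x₁, x₂} ∧ G.Edge i x₀ x₁ ∧ G.Edge i x₁ x₂ ∧
      w x₀ = -P.root i ∧ w x₁ = 0 ∧ w x₂ = P.root i)

namespace IsWeightModel

variable {G : EdgeColoredDigraph b.support R} {lam : M} {w f : R → M}
  (h : IsWeightModel G lam w f)

include h

theorem isFibrous : G.IsFibrous := by
  intro i x
  apply EdgeColoredDigraph.isChain_of_isShortString
  rcases h.string i x with ⟨hc, -⟩ | ⟨y, hy, hc, -⟩ | ⟨y, hy, hc, -⟩ | ⟨x₀, x₁, x₂, hc, h0, h1, -⟩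
  · exact .inl hc
  · exact .inr (.inl ⟨y, hy, hc⟩)
  · exact .inr (.inr (.inl ⟨y, hy, hc⟩))
  · exact .inr (.inr (.inr ⟨x₀, x₁, x₂, hc, h0, h1⟩))

theorem coroot'_nonneg_of_forall_not_edge {i : b.support} {x : R} (hx : ∀ y, ¬ G.Edge i x y) :
    0 ≤ P.coroot' i (w x) ∧ P.coroot' i (w x) ≤ 2 := by
  rcases h.string i x with
    ⟨-, hc⟩ | ⟨y, hy, -⟩ | ⟨-, -, -, hc⟩ | ⟨x₀, x₁, x₂, hc, h0, h1, -, -, hw⟩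
  · norm_num [hc]
  · exact absurd hy (hx y)
  · norm_num [hc]
  · have hxc : x ∈ G.comp {i} x := mem_comp_self
    rw [hc] at hxc
    rcases hxc with rfl | rfl | rfl
    · exact absurd h0 (hx _)
    · exact absurd h1 (hx _)
    · norm_num [hw]

/-- Without edges all strings are points, so `lam` pairs to zero with every simple coroot and would
vanish. -/
theorem exists_edge [P.IsRootSystem] : ∃ i x y, G.Edge i x y := by
  by_contra! contra
  obtain ⟨x, rfl⟩ := h.exists_eq
  refine h.ne_zero (b.eq_of_forall_coroot'_eq fun i ↦ ?_)
  rw [map_zero]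
  rcases h.string i x with ⟨-, hc⟩ | ⟨y, hy, -⟩ | ⟨y, hy, -⟩ | ⟨x₀, x₁, x₂, -, hy, -⟩
  · exact hc
  · exact absurd hy (contra _ _ _)
  · exact absurd hy (contra _ _ _)
  · exact absurd hy (contra _ _ _)

theorem exists_mem_comp_wt_eq_reflection (i : b.support) (x : R) :
    ∃ z ∈ G.comp {i} x, w z = P.reflection i (w x) := by
  rcases h.string i x with
    ⟨-, hc⟩ | ⟨y, hy, -, hc⟩ | ⟨y, hy, -, hc⟩ | ⟨x₀, x₁, x₂, hc, h0, h1, hw0, hw1, hw2⟩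
  · exact ⟨x, mem_comp_self, by rw [reflection_apply, hc, zero_smul, sub_zero]⟩
  · refine ⟨y, mem_comp_of_edge rfl hy, ?_⟩
    rw [reflection_apply, hc, neg_smul, one_smul, sub_neg_eq_add, h.wt_edge i x y hy]
  · refine ⟨y, mem_comp_of_edge' rfl hy, ?_⟩
    rw [reflection_apply, hc, one_smul, h.wt_edge i y x hy, add_sub_cancel_right]
  · have hxc : x ∈ G.comp {i} x := mem_comp_self
    rw [hc] at hxc ⊢
    rcases hxc with rfl | rfl | rfl
    · exact ⟨x₂, by simp, by rw [hw0, hw2, map_neg, reflection_apply_self, neg_neg]⟩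
    · exact ⟨x, by simp, by rw [hw1, map_zero]⟩
    · exact ⟨x₀, by simp, by rw [hw0, hw2, reflection_apply_self]⟩

theorem exists_mem_comp_wt_eq [Finite ι] [P.IsCrystallographic] [P.IsReduced] {x : R}
    (hx : w x = lam) {μ : M} (hμ : μ ∈ orbit P.weylGroup lam) :
    ∃ y ∈ G.comp Set.univ x, w y = μ := by
  refine orbit_subset_of_reflection_mem (P := P) (S := {μ | ∃ y ∈ G.comp Set.univ x, w y = μ})
    (b.forall_reflection_mem ?_) ⟨x, mem_comp_self, hx⟩ hμ
  rintro i hi _ ⟨y, hy, rfl⟩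
  obtain ⟨z, hz, hz'⟩ := h.exists_mem_comp_wt_eq_reflection ⟨i, hi⟩ y
  refine ⟨z, ?_, hz'⟩
  rw [← comp_eq_of_mem hy]
  exact EdgeColoredDigraph.comp_mono (Set.subset_univ _) hz

/-- Simple reflections are realized inside components, so a vertex of weight `lam` is connected to
one of each weight in the orbit. Nonzero weights determine vertices, and vertices of weight zero are
joined by an edge to one of nonzero weight. -/
theorem isConnected [Finite ι] [P.IsCrystallographic] [P.IsReduced] : G.IsConnected := by
  obtain ⟨x₀, hx₀⟩ := h.exists_eq
  have hne (x : R) (hx : w x ≠ 0) : x ∈ G.comp Set.univ x₀ := by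
    obtain ⟨y, hy, hyx⟩ := h.exists_mem_comp_wt_eq hx₀ (h.mem_orbit x hx)
    rwa [← h.injective x y hyx.symm hx] at hy
  have hall (x : R) : x ∈ G.comp Set.univ x₀ := by
    by_cases hx : w x = 0
    · obtain ⟨k, ⟨y, hy⟩, -⟩ := h.middle x hx
      have hwy := h.wt_edge k x y hy
      rw [hx, zero_add] at hwy
      have hyc := hne y (by rw [hwy]; exact P.ne_zero _)
      rw [← comp_eq_of_mem hyc]
      exact mem_comp_of_edge' trivial hy
    · exact hne x hx
  intro x y
  rw [comp_eq_of_mem (hall x)]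
  exact hall y

theorem exists_sub_eq {i j : b.support} {x y : R} (hy : y ∈ G.comp {i, j} x) :
    ∃ s t : ℤ, w y - w x = s • P.root i + t • P.root j := by
  refine comp_subset (S := {y | ∃ s t : ℤ, w y - w x = s • P.root i + t • P.root j})
    ⟨0, 0, by simp⟩ ?_ hy
  rintro k hk u v huv
  have hw := h.wt_edge k u v huv
  rcases hk with rfl | rfl
  · constructor
    · rintro ⟨s, t, hst⟩
      refine ⟨s + 1, t, ?_⟩
      rw [hw, add_sub_right_comm, hst]
      module
    · rintro ⟨s, t, hst⟩
      refine ⟨s - 1, t, ?_⟩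
      rw [hw, add_sub_right_comm] at hst
      rw [eq_sub_of_add_eq hst]
      module
  · constructor
    · rintro ⟨s, t, hst⟩
      refine ⟨s, t + 1, ?_⟩
      rw [hw, add_sub_right_comm, hst]
      module
    · rintro ⟨s, t, hst⟩
      refine ⟨s, t - 1, ?_⟩
      rw [hw, add_sub_right_comm] at hst
      rw [eq_sub_of_add_eq hst]
      module

/-- A function that is invariant under the reflections `s_i` for `i ∈ J` is constant on the
`J`-components. -/
theorem apply_eq_of_mem_comp {α : Type*} {J : Set b.support} (F : M → α)
    (hF : ∀ i ∈ J, ∀ μ, F (P.reflection i μ) = F μ) {x y : R} (hy : y ∈ G.comp J x) :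
    F (f y) = F (f x) := by
  refine comp_subset (S := {y | F (f y) = F (f x)}) rfl ?_ hy
  intro i hi u v huv
  have : F (f v) = F (f u) := by
    rcases h.edge i u v huv with hf | hf <;> rw [hf]
    exact hF i hi _
  simp only [Set.mem_ofPred_eq, this]

/-- The hypothesis `hij` isolates the rank-two argument about weights, so that the orthogonal and
the A₂ case share everything else. -/
theorem existsUnique_isMaximalIn [PartialOrder R] [Finite R] (hG : ∀ i x y, G.Edge i x y → x ⋖ y)
    {i j : b.support}
    (hij : ∀ (μ ν : M) (s t : ℤ), μ - ν = s • P.root i + t • P.root j →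
      (∀ k ∈ ({i, j} : Set b.support), (0 ≤ P.coroot' k μ ∧ P.coroot' k μ ≤ 2) ∧
        (0 ≤ P.coroot' k ν ∧ P.coroot' k ν ≤ 2)) →
      (∀ F : M → ℝ, (∀ k ∈ ({i, j} : Set b.support), ∀ μ, F (P.reflection k μ) = F μ) →
        F μ = F ν) → μ = ν) (x : R) :
    ∃! m, G.IsMaximalIn {i, j} x m := by
  obtain ⟨m, -, hm⟩ := EdgeColoredDigraph.exists_isMaximalIn hG {i, j} x
  refine ⟨m, hm, fun m' hm' ↦ ?_⟩
  have hmm' : m' ∈ G.comp {i, j} m := by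
    rw [comp_eq_of_mem hm.1]; exact hm'.1
  -- A vertex of weight zero has an edge leaving it in its only color. If it is maximal, that color
  -- is neither `i` nor `j`, so its {i,j}-component is a point.
  have hzero (u v : R) (huv : v ∈ G.comp {i, j} u)
      (hu : ∀ k ∈ ({i, j} : Set b.support), ∀ y, ¬ G.Edge k u y) (hw : w u = 0) : v = u := by
    obtain ⟨k, ⟨y, hy⟩, hk⟩ := h.middle u hw
    have hsing : G.comp {i, j} u = {u} := by
      refine comp_eq_singleton fun l hl y' ↦ ?_
      have hlk : l ≠ k := by
        rintro rfl
        exact hu l hl y hy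
      have hc := hk l hlk
      constructor
      · intro hy'
        have hmem : y' ∈ G.comp {l} u := mem_comp_of_edge rfl hy'
        rw [hc] at hmem
        exact (hG _ _ _ hy').lt.ne' hmem
      · intro hy'
        have hmem : y' ∈ G.comp {l} u := mem_comp_of_edge' rfl hy'
        rw [hc] at hmem
        exact (hG _ _ _ hy').lt.ne hmem
    rw [hsing] at huv
    exact huv
  by_cases hwm : w m = 0
  · exact hzero m m' hmm' hm.2 hwm
  by_cases hwm' : w m' = 0
  · refine (hzero m' m ?_ hm'.2 hwm').symm
    rw [comp_eq_of_mem hmm']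
    exact mem_comp_self
  obtain ⟨s, t, hst⟩ := h.exists_sub_eq hmm'
  refine h.injective m' m (hij _ _ s t hst (fun k hk ↦
    ⟨h.coroot'_nonneg_of_forall_not_edge (hm'.2 k hk),
      h.coroot'_nonneg_of_forall_not_edge (hm.2 k hk)⟩) fun F hF ↦ ?_) hwm'
  rw [← h.eq_of_ne_zero m hwm, ← h.eq_of_ne_zero m' hwm']
  exact h.apply_eq_of_mem_comp F hF hmm'

theorem existsUnique_isMaximalIn_of_orthogonal [PartialOrder R] [Finite R]
    (hG : ∀ i x y, G.Edge i x y → x ⋖ y) {i j : b.support} (hij : P.pairing i j = 0)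
    (hji : P.pairing j i = 0) (x : R) : ∃! m, G.IsMaximalIn {i, j} x m := by
  refine h.existsUnique_isMaximalIn hG (fun μ ν s t hst hc hF ↦ ?_) x
  -- The function |⟨·, α_k^∨⟩| is invariant, as s_k changes the sign of the pairing and s_l fixes
  -- it. Both values are nonnegative before taking absolute values.
  have habs (k l : b.support) (hkl : P.pairing l k = 0) (hkl' : P.pairing k l = 0)
      (hkl'' : ({k, l} : Set b.support) = {i, j}) : P.coroot' k μ = P.coroot' k ν := by
    have h1 := hF (fun μ ↦ |P.coroot' k μ|) (by
      rw [← hkl'']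
      rintro _ (rfl | rfl) μ
      · simp only [reflection_apply, map_sub, map_smul, root_coroot'_eq_pairing, pairing_same,
          smul_eq_mul]
        rw [← abs_neg]
        congr 1
        ring
      · simp [reflection_apply, hkl])
    obtain ⟨⟨h2, -⟩, h3, -⟩ := hc k (by rw [← hkl'']; simp)
    simpa only [abs_of_nonneg h2, abs_of_nonneg h3] using h1
  have hi := habs i j hji hij rfl
  have hj := habs j i hij hji (Set.pair_comm j i)
  have hi' := congrArg (P.coroot' i) hst
  have hj' := congrArg (P.coroot' j) hst
  simp only [map_sub, map_add, map_zsmul, root_coroot'_eq_pairing, pairing_same, hij, hji, hi, hj,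
    sub_self, smul_zero, add_zero, zero_add, zsmul_eq_mul] at hi' hj'
  have hs : s = 0 := by
    have : (s : ℝ) = 0 := by linarith
    exact_mod_cast this
  have ht : t = 0 := by
    have : (t : ℝ) = 0 := by linarith
    exact_mod_cast this
  rw [hs, ht, zero_smul, zero_smul, add_zero, sub_eq_zero] at hst
  exact hst

theorem existsUnique_isMaximalIn_of_pairing_eq_neg_one [PartialOrder R] [Finite R] [Fintype ι]
    [P.IsRootSystem] (hG : ∀ i x y, G.Edge i x y → x ⋖ y) {i j : b.support}
    (hij : P.pairing i j = -1) (hji : P.pairing j i = -1) (x : R) :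
    ∃! m, G.IsMaximalIn {i, j} x m := by
  refine h.existsUnique_isMaximalIn hG (fun μ ν s t hst hc hF ↦ ?_) x
  have hnorm : P.RootForm μ μ = P.RootForm ν ν := hF (fun μ ↦ P.RootForm μ μ) (by simp)
  obtain ⟨hμi, hνi⟩ := hc i (by simp)
  obtain ⟨hμj, hνj⟩ := hc j (by simp)
  have hi' := congrArg (P.coroot' i) hst
  have hj' := congrArg (P.coroot' j) hst
  simp only [map_sub, map_add, map_zsmul, root_coroot'_eq_pairing, pairing_same, hij, hji,
    zsmul_eq_mul] at hi' hj'
  have hsmul (k : ι) (s : ℤ) : s • P.root k = (s : ℝ) • P.root k := (Int.cast_smul_eq_zsmul ..).symm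
  have hcases : (0 ≤ s ∧ 0 ≤ t) ∨ (s ≤ 0 ∧ t ≤ 0) ∨ (1 ≤ s ∧ t ≤ -1) ∨ (s ≤ -1 ∧ 1 ≤ t) := by
    omega
  rcases hcases with ⟨hs, ht⟩ | ⟨hs, ht⟩ | ⟨hs, ht⟩ | ⟨hs, ht⟩
  · rw [hsmul, hsmul] at hst
    exact eq_of_rootForm_eq_of_nonneg hst (by exact_mod_cast hs) (by exact_mod_cast ht) hμi.1 hμj.1
      hνi.1 hνj.1 hnorm
  · have hst' : ν - μ = ((-s : ℤ) : ℝ) • P.root i + ((-t : ℤ) : ℝ) • P.root j := by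
      rw [← hsmul, ← hsmul, ← neg_sub, hst]
      module
    exact (eq_of_rootForm_eq_of_nonneg hst' (by exact_mod_cast neg_nonneg.mpr hs)
      (by exact_mod_cast neg_nonneg.mpr ht) hνi.1 hνj.1 hμi.1 hμj.1 hnorm.symm).symm
  -- Here ⟨μ - ν, α_i^∨⟩ = 2s - t ≥ 3, while both pairings lie in [0,2]; the last case is symmetric.
  · have hs' : (1 : ℝ) ≤ s := by exact_mod_cast hs
    have ht' : (t : ℝ) ≤ -1 := by exact_mod_cast ht
    linarith [hμi.2, hνi.1]
  · have hs' : (s : ℝ) ≤ -1 := by exact_mod_cast hs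
    have ht' : (1 : ℝ) ≤ t := by exact_mod_cast ht
    linarith [hμj.2, hνj.1]

section Rank

variable [PartialOrder R] (ρ : RankFunction R) (hG : ∀ i x y, G.Edge i x y → x ⋖ y)

include hG

theorem compWeight_eq (i : b.support) (x : R) : (ρ.compWeight G i x : ℝ) = P.coroot' i (w x) := by
  rw [RankFunction.compWeight]
  rcases h.string i x with
    ⟨hc, hw⟩ | ⟨y, hy, hc, hw⟩ | ⟨y, hy, hc, hw⟩ | ⟨x₀, x₁, x₂, hc, h0, h1, hw0, hw1, hw2⟩
  · obtain ⟨h1, h2⟩ := ρ.compLength_compRank_of_comp_eq_singleton hc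
    rw [h1, h2, hw]; norm_num
  · obtain ⟨⟨h1, h2⟩, -⟩ := ρ.compLength_compRank_of_comp_eq_pair hG hc hy
    rw [h1, h2, hw]; norm_num
  · obtain ⟨-, h1, h2⟩ := ρ.compLength_compRank_of_comp_eq_pair hG hc hy
    rw [h1, h2, hw]; norm_num
  · obtain ⟨h2, h3, h4⟩ := ρ.compLength_compRank_of_comp_eq_triple hG hc h0 h1
    have hxc : x ∈ G.comp {i} x := mem_comp_self
    rw [hc] at hxc
    rcases hxc with rfl | rfl | rfl
    · rw [h2.1, h2.2, hw0]; norm_num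
    · rw [h3.1, h3.2, hw1]; norm_num
    · rw [h4.1, h4.2, hw2]; norm_num

theorem wt_eq [P.IsRootSystem] (x : R) : b.wt ρ G x = w x :=
  b.eq_of_forall_coroot'_eq fun i ↦ by rw [coroot'_wt, h.compWeight_eq ρ hG]

theorem isStructured [P.IsRootSystem] : b.IsStructured ρ G := by
  intro i x y hxy
  rw [h.wt_eq ρ hG, h.wt_eq ρ hG, h.wt_edge i x y hxy]

theorem string_of_two_le_compLength {i : b.support} {x : R} (hl : 2 ≤ ρ.compLength G i x) :
    ∃ x₀ x₁ x₂, G.comp {i} x = {x₀, x₁, x₂} ∧ G.Edge i x₀ x₁ ∧ G.Edge i x₁ x₂ ∧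
      w x₀ = -P.root i ∧ w x₁ = 0 ∧ w x₂ = P.root i := by
  rcases h.string i x with ⟨hc, -⟩ | ⟨y, hy, hc, -⟩ | ⟨y, hy, hc, -⟩ | hs
  · have := ρ.compLength_compRank_of_comp_eq_singleton hc
    omega
  · have := ρ.compLength_compRank_of_comp_eq_pair hG hc hy
    omega
  · have := ρ.compLength_compRank_of_comp_eq_pair hG hc hy
    omega
  · exact hs

/-- Nonzero weight excludes the middle of a long chain, where the pairing is 0 but the depth is 1.
-/
theorem compDepth_eq_zero {i : b.support} {x : R} (hx : 0 ≤ P.coroot' i (w x)) (hx0 : w x ≠ 0) :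
    ρ.compDepth G i x = 0 := by
  rw [RankFunction.compDepth]
  rcases h.string i x with
    ⟨hc, hw⟩ | ⟨y, hy, hc, hw⟩ | ⟨y, hy, hc, hw⟩ | ⟨x₀, x₁, x₂, hc, h0, h1, hw0, hw1, hw2⟩
  · have := ρ.compLength_compRank_of_comp_eq_singleton hc
    omega
  · norm_num [hw] at hx
  · have := ρ.compLength_compRank_of_comp_eq_pair hG hc hy
    omega
  · have hl := ρ.compLength_compRank_of_comp_eq_triple hG hc h0 h1
    have hxc : x ∈ G.comp {i} x := mem_comp_self
    rw [hc] at hxc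
    rcases hxc with rfl | rfl | rfl
    · norm_num [hw0] at hx
    · exact absurd hw1 hx0
    · omega

theorem compRank_eq_zero {i : b.support} {x : R} (hx : P.coroot' i (w x) ≤ 0) (hx0 : w x ≠ 0) :
    ρ.compRank G i x = 0 := by
  rcases h.string i x with
    ⟨hc, hw⟩ | ⟨y, hy, hc, hw⟩ | ⟨y, hy, hc, hw⟩ | ⟨x₀, x₁, x₂, hc, h0, h1, hw0, hw1, hw2⟩
  · have := ρ.compLength_compRank_of_comp_eq_singleton hc
    omega
  · have := ρ.compLength_compRank_of_comp_eq_pair hG hc hy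
    omega
  · norm_num [hw] at hx
  · have hl := ρ.compLength_compRank_of_comp_eq_triple hG hc h0 h1
    have hxc : x ∈ G.comp {i} x := mem_comp_self
    rw [hc] at hxc
    rcases hxc with rfl | rfl | rfl
    · omega
    · exact absurd hw1 hx0
    · norm_num [hw2] at hx

theorem long [Finite ι] [P.IsCrystallographic] {i : b.support} {x : R}
    (hl : 2 ≤ ρ.compLength G i x) :
    ∃ x₀ x₁ x₂, G.comp {i} x = {x₀, x₁, x₂} ∧ G.Edge i x₀ x₁ ∧ G.Edge i x₁ x₂ ∧
      ∀ j, j ≠ i → ρ.compDepth G j x₀ = 0 ∧ ρ.compRank G j x₂ = 0 ∧ G.comp {j} x₁ = {x₁} := by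
  obtain ⟨x₀, x₁, x₂, hc, h0, h1, hw0, hw1, hw2⟩ := h.string_of_two_le_compLength ρ hG hl
  refine ⟨x₀, x₁, x₂, hc, h0, h1, fun j hj ↦ ?_⟩
  -- Off-diagonal Cartan integers are nonpositive, so -α_i pairs nonnegatively and α_i nonpositively
  -- with the other simple coroots.
  have hle : P.pairing i j ≤ 0 := by
    have h2 := b.cartanMatrix_le_zero_of_ne i j hj.symm
    have h3 : ((b.cartanMatrix i j : ℤ) : ℝ) = P.pairing i j :=
      b.algebraMap_cartanMatrixIn_apply ℤ i j
    rw [← h3]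
    exact_mod_cast h2
  refine ⟨h.compDepth_eq_zero ρ hG ?_ ?_, h.compRank_eq_zero ρ hG ?_ ?_, ?_⟩
  · rw [hw0, map_neg, root_coroot'_eq_pairing]
    linarith
  · rw [hw0, neg_ne_zero]
    exact P.ne_zero _
  · rwa [hw2, root_coroot'_eq_pairing]
  · rw [hw2]
    exact P.ne_zero _
  · obtain ⟨k, -, hk⟩ := h.middle x₁ hw1
    have hik : i = k := by
      by_contra hne
      have hmem : x₂ ∈ G.comp {i} x₁ := mem_comp_of_edge rfl h1
      rw [hk i hne] at hmem
      exact (hG _ _ _ h1).lt.ne' hmem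
    exact hk j (hik ▸ hj)

end Rank

end IsWeightModel

theorem IsWeightModel.of_equiv {V : Type*} {G : EdgeColoredDigraph b.support R}
    {G' : EdgeColoredDigraph b.support V} {lam : M} {w f : V → M}
    (h : IsWeightModel G' lam w f) (e : R ≃ V)
    (he : ∀ i x y, G.Edge i x y ↔ G'.Edge i (e x) (e y)) :
    IsWeightModel G lam (w ∘ e) (f ∘ e) := by
  have hcomp (J : Set b.support) (x : R) : G.comp J x = e ⁻¹' G'.comp J (e x) := by
    refine Set.Subset.antisymm (comp_subset mem_comp_self ?_) fun y hy ↦ ?_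
    · intro i hi u v huv
      rw [he] at huv
      simp only [Set.mem_preimage]
      exact ⟨fun hu ↦ comp_eq_of_mem hu ▸ mem_comp_of_edge hi huv,
        fun hv ↦ comp_eq_of_mem hv ▸ mem_comp_of_edge' hi huv⟩
    · have : G'.comp J (e x) ⊆ e.symm ⁻¹' G.comp J x := by
        refine comp_subset (by simp [mem_comp_self]) fun i hi u v huv ↦ ?_
        have huv' : G.Edge i (e.symm u) (e.symm v) := by rw [he]; simpa using huv
        simp only [Set.mem_preimage]
        exact ⟨fun hu ↦ comp_eq_of_mem hu ▸ mem_comp_of_edge hi huv',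
          fun hv ↦ comp_eq_of_mem hv ▸ mem_comp_of_edge' hi huv'⟩
      simpa using this hy
  refine ⟨fun i x y hxy ↦ h.wt_edge i _ _ ((he i x y).mp hxy),
    fun i x y hxy ↦ h.edge i _ _ ((he i x y).mp hxy), fun x ↦ h.eq_of_ne_zero _,
    fun x y hxy hx ↦ e.injective (h.injective _ _ hxy hx), fun x ↦ h.mem_orbit _, ?_, h.ne_zero,
    fun x hx ↦ ?_, fun i x ↦ ?_⟩
  · obtain ⟨v, hv⟩ := h.exists_eq
    exact ⟨e.symm v, by simpa using hv⟩
  · obtain ⟨k, ⟨y, hy⟩, hk⟩ := h.middle _ hx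
    refine ⟨k, ⟨e.symm y, by rw [he]; simpa using hy⟩, fun j hj ↦ ?_⟩
    ext z
    simp [hcomp, hk j hj]
  · have hsymm (y : V) : y = e (e.symm y) := (e.apply_symm_apply y).symm
    rcases h.string i (e x) with ⟨hc, hw⟩ | ⟨y, hy, hc, hw⟩ | ⟨y, hy, hc, hw⟩ |
      ⟨x₀, x₁, x₂, hc, h0, h1, hw0, hw1, hw2⟩
    · exact .inl ⟨by ext z; simp [hcomp, hc], hw⟩
    · refine .inr (.inl ⟨e.symm y, by rw [he]; simpa using hy, ?_, hw⟩)
      ext z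
      simp [hcomp, hc, e.eq_symm_apply]
    · refine .inr (.inr (.inl ⟨e.symm y, by rw [he]; simpa using hy, ?_, hw⟩))
      ext z
      simp [hcomp, hc, e.eq_symm_apply]
    · refine .inr (.inr (.inr ⟨e.symm x₀, e.symm x₁, e.symm x₂, ?_, by rw [he]; simpa using h0,
        by rw [he]; simpa using h1, by simpa using hw0, by simpa using hw1, by simpa using hw2⟩))
      ext z
      simp [hcomp, hc, e.eq_symm_apply]

end RootPairing.Base

/-! ### The splitting posets are weight models -/

namespace RootPairing.Base

variable {ι M N : Type*} [AddCommGroup M] [Module ℝ M] [AddCommGroup N] [Module ℝ N]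
variable {P : RootPairing ι ℝ M N} [P.IsRootSystem] {b : P.Base}
variable {R : Type*} {G : EdgeColoredDigraph b.support R} {lam : M}

theorem IsMinuscule.ne_zero_of_mem_orbit (hm : b.IsMinuscule lam) {μ : M}
    (hμ : μ ∈ MulAction.orbit P.weylGroup lam) : μ ≠ 0 :=
  orbit_subset_of_reflection_mem (P := P) (S := {μ | μ ≠ 0})
    (fun k μ hμ ↦ by simpa using hμ) hm.2.1 hμ

/-- No weight is zero, so no relabelling is needed, and an edge runs from pairing -1 to pairing 1,
so strings cannot be continued. -/
theorem isWeightModel_of_minuscule [Fintype ι] (hd : b.IsDominant lam) (hm : b.IsMinuscule lam)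
    (e : R ≃ b.weightDiagram lam)
    (he : ∀ i x y, G.Edge i x y ↔ (b.minusculePoset lam).Edge i (e x) (e y)) :
    IsWeightModel G lam (fun x ↦ (e x : M)) (fun x ↦ (e x : M)) := by
  have hdiag := hm.weightDiagram_eq hd
  have hmem (x : R) : (e x : M) ∈ orbit P.weylGroup lam := hdiag ▸ (e x).2
  have hedge (i : b.support) (x y : R) : G.Edge i x y ↔ (e y : M) = e x + P.root i := by
    rw [he]
    change b.WeightDiagramEdge lam i (e x) (e y) ↔ _
    rw [weightDiagramEdge_iff]
    exact ⟨fun h ↦ h.2.2, fun h ↦ ⟨(e x).2, (e y).2, h⟩⟩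
  have hinj (x y : R) (hxy : (e x : M) = e y) : x = y := e.injective (Subtype.ext hxy)
  have hval (i : b.support) (x : R) := coroot'_mem_of_mem_orbit hm.2.2 (hmem x) i
  have hneg (i : b.support) (x y : R) (hxy : G.Edge i x y) :
      P.coroot' i (e x : M) = -1 ∧ P.coroot' i (e y : M) = 1 := by
    have h1 := hval i x
    have h2 := hval i y
    have h3 := congrArg (P.coroot' i) ((hedge i x y).mp hxy)
    rw [map_add, root_coroot'_eq_pairing, pairing_same] at h3
    simp only [Set.mem_insert_iff, Set.mem_singleton_iff] at h1 h2
    grind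
  have hsurj (i : b.support) (x : R) : ∃ y, (e y : M) = P.reflection i (e x) := by
    have : P.reflection i (e x) ∈ b.weightDiagram lam :=
      hdiag.ge (reflection_mem_orbit (i : ι) (hmem x))
    exact ⟨e.symm ⟨_, this⟩, by simp⟩
  have hpair (i : b.support) (x y : R) (hxy : G.Edge i x y) : G.comp {i} x = {x, y} := by
    refine EdgeColoredDigraph.comp_eq_pair hxy (fun z hz ↦ ?_) (fun z hz ↦ ?_) (fun z hz ↦ ?_)
      (fun z hz ↦ ?_)
    · exact hinj _ _ (((hedge i x z).mp hz).trans ((hedge i x y).mp hxy).symm)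
    · exact hinj _ _ (add_right_cancel
        (((hedge i z y).mp hz).symm.trans ((hedge i x y).mp hxy)))
    · have h1 := (hneg i z x hz).2
      norm_num [(hneg i x y hxy).1] at h1
    · have h1 := (hneg i y z hz).1
      norm_num [(hneg i x y hxy).2] at h1
  have hne0 (x : R) : (e x : M) ≠ 0 := hm.ne_zero_of_mem_orbit (hmem x)
  refine ⟨fun i x y ↦ (hedge i x y).mp, fun i x y hxy ↦ .inl ?_, fun x _ ↦ rfl,
    fun x y hxy _ ↦ hinj x y hxy, fun x _ ↦ hmem x, ?_, hm.2.1, fun x hx ↦ absurd hx (hne0 x),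
    fun i x ↦ ?_⟩
  · rw [reflection_apply, (hneg i x y hxy).1, (hedge i x y).mp hxy, neg_smul, one_smul,
      sub_neg_eq_add]
  · exact ⟨e.symm ⟨lam, hdiag ▸ MulAction.mem_orbit_self _⟩, by simp⟩
  · have h1 := hval i x
    obtain ⟨y, hy⟩ := hsurj i x
    simp only [Set.mem_insert_iff, Set.mem_singleton_iff] at h1
    rcases h1 with h1 | h1 | h1
    · refine .inl ⟨comp_eq_singleton ?_, h1⟩
      rintro k hk y
      obtain rfl : k = i := hk
      constructor
      · intro hxy
        have := (hneg k x y hxy).1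
        norm_num [h1] at this
      · intro hxy
        have := (hneg k y x hxy).2
        norm_num [h1] at this
    · rw [reflection_apply, h1, one_smul] at hy
      have hyx : G.Edge i y x := (hedge i y x).mpr (by rw [hy, sub_add_cancel])
      refine .inr (.inr (.inl ⟨y, hyx, ?_, h1⟩))
      rw [← hpair i y x hyx, comp_eq_of_mem (mem_comp_of_edge (Set.mem_singleton i) hyx)]
    · rw [reflection_apply, h1, neg_smul, one_smul, sub_neg_eq_add] at hy
      have hxy : G.Edge i x y := (hedge i x y).mpr hy
      exact .inr (.inl ⟨y, hxy, hpair i x y hxy, h1⟩)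

section QuasiMinuscule

variable [Fintype ι]

/-- The weight of a vertex of the quasi-minuscule splitting poset. -/
def orbitWeight : orbit P.weylGroup lam ⊕ {i : b.support // b.IsShort i} → M
  | .inl μ => μ
  | .inr _ => 0

/-- The weights of the quasi-minuscule splitting poset, with the weight zero of `ᾱ_i` replaced by
the simple root `α_i`. -/
def orbitRoot : orbit P.weylGroup lam ⊕ {i : b.support // b.IsShort i} → M
  | .inl μ => μ
  | .inr j => P.root j.1

theorem isWeightModel_quasiMinusculePoset [P.IsCrystallographic] [P.IsReduced]
    [P.IsIrreducible] (hd : b.IsDominant lam) (hm : b.IsQuasiMinuscule lam) :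
    IsWeightModel (b.quasiMinusculePoset lam) lam orbitWeight orbitRoot := by
  have hne0 (μ : orbit P.weylGroup lam) : (μ : M) ≠ 0 := hm.ne_zero_of_mem_orbit μ.2
  have hll {i : b.support} {μ ν : orbit P.weylGroup lam} :
      (b.quasiMinusculePoset lam).Edge i (.inl μ) (.inl ν) ↔ (ν : M) = μ + P.root i := by
    change b.WeightDiagramEdge lam i μ ν ↔ _
    rw [weightDiagramEdge_iff]
    exact ⟨fun h ↦ h.2.2, fun h ↦ ⟨hd.orbit_subset_weightDiagram μ.2,
      hd.orbit_subset_weightDiagram ν.2, h⟩⟩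
  have hlr {i : b.support} {μ : orbit P.weylGroup lam} {j} :
      (b.quasiMinusculePoset lam).Edge i (.inl μ) (.inr j) ↔ j.1 = i ∧ (μ : M) = -P.root i :=
    Iff.rfl
  have hrl {i : b.support} {j} {ν : orbit P.weylGroup lam} :
      (b.quasiMinusculePoset lam).Edge i (.inr j) (.inl ν) ↔ j.1 = i ∧ (ν : M) = P.root i :=
    Iff.rfl
  have hrr {i : b.support} {j k} :
      ¬ (b.quasiMinusculePoset lam).Edge i (.inr j) (.inr k) := id
  have hval (i : b.support) (μ : orbit P.weylGroup lam) :=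
    coroot'_mem_of_mem_orbit hm.2.1 μ.2 i
  have htwo (i : b.support) (μ : orbit P.weylGroup lam) := hm.coroot'_eq_two_iff μ.2 i
  have hntwo (i : b.support) (μ : orbit P.weylGroup lam) := hm.coroot'_eq_neg_two_iff μ.2 i
  -- The other possible pairs, (0, 2) and (-2, 0), would make μ or ν zero, because ±2 is only
  -- attained at ±α_i.
  have hone {i : b.support} {μ ν : orbit P.weylGroup lam} (h : (ν : M) = μ + P.root i) :
      P.coroot' i (μ : M) = -1 ∧ P.coroot' i (ν : M) = 1 := by
    have h1 := hval i μ
    have h2 := hval i ν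
    have h3 := congrArg (P.coroot' i) h
    rw [map_add, root_coroot'_eq_pairing, pairing_same] at h3
    have h4 : P.coroot' i (μ : M) ≠ 0 := by
      intro h0
      rw [h0, zero_add, htwo] at h3
      rw [h3, right_eq_add] at h
      exact hne0 μ h
    have h5 : P.coroot' i (μ : M) ≠ -2 := by
      intro h0
      rw [hntwo] at h0
      rw [h0, neg_add_cancel] at h
      exact hne0 ν h
    simp only [Set.mem_insert_iff, Set.mem_singleton_iff] at h1 h2
    grind
  have hpair {i : b.support} {μ ν : orbit P.weylGroup lam} (h : (ν : M) = μ + P.root i) :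
      (b.quasiMinusculePoset lam).comp {i} (.inl μ) = {.inl μ, .inl ν} := by
    obtain ⟨h1, h2⟩ := hone h
    have h3 : (μ : M) ≠ -P.root i := by rw [Ne, ← hntwo, h1]; norm_num
    have h4 : (μ : M) ≠ P.root i := by rw [Ne, ← htwo, h1]; norm_num
    have h5 : (ν : M) ≠ -P.root i := by rw [Ne, ← hntwo, h2]; norm_num
    have h6 : (ν : M) ≠ P.root i := by rw [Ne, ← htwo, h2]; norm_num
    refine EdgeColoredDigraph.comp_eq_pair (hll.mpr h) ?_ ?_ ?_ ?_
    · rintro (ξ | j) hz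
      · exact congrArg Sum.inl (Subtype.ext ((hll.mp hz).trans h.symm))
      · exact absurd (hlr.mp hz).2 h3
    · rintro (ξ | j) hz
      · exact congrArg Sum.inl (Subtype.ext (add_right_cancel ((hll.mp hz).symm.trans h)))
      · exact absurd (hrl.mp hz).2 h6
    · rintro (ξ | j) hz
      · have := (hone (hll.mp hz)).2
        norm_num [h1] at this
      · exact absurd (hrl.mp hz).2 h4
    · rintro (ξ | j) hz
      · have := (hone (hll.mp hz)).1
        norm_num [h2] at this
      · exact absurd (hlr.mp hz).2 h5
  have htriple {i : b.support} (hi : b.IsShort i) : ∃ μ ν : orbit P.weylGroup lam,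
      (μ : M) = -P.root i ∧ (ν : M) = P.root i ∧
      (b.quasiMinusculePoset lam).comp {i} (.inl μ) = {.inl μ, .inr ⟨i, hi⟩, .inl ν} := by
    have hmem := (hm.root_mem_orbit_iff i).mpr hi
    have hmem' := reflection_mem_orbit (i : ι) hmem
    rw [reflection_apply_self] at hmem'
    refine ⟨⟨_, hmem'⟩, ⟨_, hmem⟩, rfl, rfl, ?_⟩
    have hc : P.coroot' i (P.root i) = 2 := by rw [root_coroot'_eq_pairing, pairing_same]
    have hc' : P.coroot' i (-P.root i) = -2 := by rw [map_neg, hc]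
    have hne : P.root i ≠ -P.root i := by
      intro h
      rw [← h, hc] at hc'
      norm_num at hc'
    refine EdgeColoredDigraph.comp_eq_triple (hlr.mpr ⟨rfl, rfl⟩) (hrl.mpr ⟨rfl, rfl⟩)
      ?_ ?_ ?_ ?_ ?_ ?_
    · rintro (ξ | j) hz
      · have := (hone (hll.mp hz)).1
        norm_num [hc'] at this
      · exact congrArg Sum.inr (Subtype.ext (hlr.mp hz).1)
    · rintro (ξ | j) hz
      · exact congrArg Sum.inl (Subtype.ext (hlr.mp hz).2)
      · exact absurd hz hrr
    · rintro (ξ | j) hz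
      · exact congrArg Sum.inl (Subtype.ext (hrl.mp hz).2)
      · exact absurd hz hrr
    · rintro (ξ | j) hz
      · have := (hone (hll.mp hz)).2
        norm_num [hc] at this
      · exact congrArg Sum.inr (Subtype.ext (hrl.mp hz).1)
    · rintro (ξ | j) hz
      · have := (hone (hll.mp hz)).2
        norm_num [hc'] at this
      · exact hne (hrl.mp hz).2.symm
    · rintro (ξ | j) hz
      · have := (hone (hll.mp hz)).1
        norm_num [hc] at this
      · exact hne (hlr.mp hz).2
  have hshort {i : b.support} {μ : orbit P.weylGroup lam} (h : (μ : M) = P.root i) :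
      b.IsShort i := (hm.root_mem_orbit_iff i).mp (h ▸ μ.2)
  have hstring {i : b.support} (hi : b.IsShort i) {x}
      (hx : ∀ μ ν : orbit P.weylGroup lam, (μ : M) = -P.root i → (ν : M) = P.root i →
        x ∈ ({.inl μ, .inr ⟨i, hi⟩, .inl ν} :
          Set (orbit P.weylGroup lam ⊕ {i : b.support // b.IsShort i}))) :
      ∃ x₀ x₁ x₂, (b.quasiMinusculePoset lam).comp {i} x = {x₀, x₁, x₂} ∧
        (b.quasiMinusculePoset lam).Edge i x₀ x₁ ∧ (b.quasiMinusculePoset lam).Edge i x₁ x₂ ∧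
        orbitWeight x₀ = -P.root i ∧ orbitWeight x₁ = 0 ∧ orbitWeight x₂ = P.root i := by
    obtain ⟨μ, ν, hμ, hν, hc⟩ := htriple hi
    refine ⟨.inl μ, .inr ⟨i, hi⟩, .inl ν, ?_, hlr.mpr ⟨rfl, hμ⟩, hrl.mpr ⟨rfl, hν⟩, hμ, rfl, hν⟩
    rw [← hc]
    exact comp_eq_of_mem (hc ▸ hx μ ν hμ hν)
  have hsingle {i : b.support} {j : {i : b.support // b.IsShort i}} (hij : i ≠ j.1) :
      (b.quasiMinusculePoset lam).comp {i} (.inr j) = {.inr j} := by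
    refine comp_eq_singleton ?_
    rintro k hk (ν | l)
    · obtain rfl : k = i := hk
      exact ⟨fun h ↦ hij (hrl.mp h).1.symm, fun h ↦ hij (hlr.mp h).1.symm⟩
    · exact ⟨hrr, hrr⟩
  refine ⟨?_, ?_, ?_, ?_, ?_, ⟨.inl ⟨lam, MulAction.mem_orbit_self _⟩, rfl⟩,
    hm.ne_zero_of_mem_orbit (MulAction.mem_orbit_self _), ?_, ?_⟩
  · rintro i (μ | j) (ν | k) h
    · exact hll.mp h
    · simp [orbitWeight, (hlr.mp h).2]
    · simp [orbitWeight, (hrl.mp h).2]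
    · exact absurd h hrr
  -- The edge -α_i → ᾱ_i becomes the reflection -α_i ↦ α_i, and ᾱ_i → α_i keeps the label α_i.
  · rintro i (μ | j) (ν | k) h
    · left
      have h' := hll.mp h
      simp only [orbitRoot]
      rw [reflection_apply, (hone h').1, h', neg_smul, one_smul, sub_neg_eq_add]
    · left
      obtain ⟨rfl, h'⟩ := hlr.mp h
      simp [orbitRoot, h']
    · right
      obtain ⟨rfl, h'⟩ := hrl.mp h
      exact h'
    · exact absurd h hrr
  · rintro (μ | j) h
    · rfl
    · exact absurd rfl h
  · rintro (μ | j) (ν | k) h h'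
    · exact congrArg Sum.inl (Subtype.ext h)
    · exact absurd h h'
    · exact absurd rfl h'
    · exact absurd rfl h'
  · rintro (μ | j) h
    · exact μ.2
    · exact absurd rfl h
  · rintro (μ | j) h
    · exact absurd h (hne0 μ)
    · obtain ⟨-, ν, -, hν, -⟩ := htriple j.2
      exact ⟨j.1, ⟨.inl ν, hrl.mpr ⟨rfl, hν⟩⟩, fun k hk ↦ hsingle hk⟩
  · rintro i (μ | j)
    · have h1 := hval i μ
      have hrefl := reflection_mem_orbit (i : ι) μ.2
      simp only [Set.mem_insert_iff, Set.mem_singleton_iff] at h1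
      rcases h1 with h1 | h1 | h1 | h1 | h1
      · refine .inl ⟨comp_eq_singleton ?_, h1⟩
        rintro k hk (ν | l)
        · obtain rfl : k = i := hk
          constructor
          · intro h
            have := (hone (hll.mp h)).1
            norm_num [h1] at this
          · intro h
            have := (hone (hll.mp h)).2
            norm_num [h1] at this
        · obtain rfl : k = i := hk
          constructor
          · intro h
            rw [(hntwo k μ).mpr (hlr.mp h).2] at h1
            norm_num at h1
          · intro h
            rw [(htwo k μ).mpr (hrl.mp h).2] at h1
            norm_num at h1
      · have h2 : (μ : M) = P.reflection i (μ : M) + P.root i := by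
          rw [reflection_apply, h1, one_smul, sub_add_cancel]
        have h3 := (hll (μ := ⟨_, hrefl⟩) (ν := μ)).mpr h2
        refine .inr (.inr (.inl ⟨.inl ⟨_, hrefl⟩, h3, ?_, h1⟩))
        rw [← hpair (μ := ⟨_, hrefl⟩) (ν := μ) h2,
          comp_eq_of_mem (mem_comp_of_edge (Set.mem_singleton i) h3)]
      · have h2 : P.reflection i (μ : M) = μ + P.root i := by
          rw [reflection_apply, h1, neg_smul, one_smul, sub_neg_eq_add]
        have h3 := (hll (μ := μ) (ν := ⟨_, hrefl⟩)).mpr h2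
        exact .inr (.inl ⟨.inl ⟨_, hrefl⟩, h3, hpair h2, h1⟩)
      · rw [htwo] at h1
        refine .inr (.inr (.inr (hstring (hshort h1) fun μ' ν' _ h' ↦ .inr (.inr ?_))))
        exact congrArg Sum.inl (Subtype.ext (h1.trans h'.symm))
      · rw [hntwo] at h1
        have h2 : P.reflection i (μ : M) = P.root i := by
          rw [h1, map_neg, reflection_apply_self, neg_neg]
        have hi : b.IsShort i := hshort (μ := ⟨_, hrefl⟩) h2
        refine .inr (.inr (.inr (hstring hi fun μ' ν' h' _ ↦ .inl ?_)))
        exact congrArg Sum.inl (Subtype.ext (h1.trans h'.symm))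
    · by_cases hij : i = j.1
      · subst hij
        exact .inr (.inr (.inr (hstring j.2 fun μ' ν' _ _ ↦ .inr (.inl rfl))))
      · exact .inl ⟨hsingle hij, map_zero _⟩

end QuasiMinuscule

end RootPairing.Base

/-! ### Pairs of colors and the existence of a long chain -/

namespace RootPairing.Base

variable {ι M N : Type*} [AddCommGroup M] [Module ℝ M] [AddCommGroup N] [Module ℝ N]
variable {P : RootPairing ι ℝ M N} {b : P.Base}
variable {R : Type*} [PartialOrder R] {G : EdgeColoredDigraph b.support R} {lam : M}

namespace IsWeightModel

variable [Finite R] [P.IsCrystallographic] {w f : R → M}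
  (h : IsWeightModel G lam w f) (hG : ∀ i x y, G.Edge i x y → x ⋖ y)

include h hG

theorem existsUnique_isMaximalIn_of_cartanMatrix_eq_zero {i j : b.support}
    (hij : b.cartanMatrix i j = 0) (hji : b.cartanMatrix j i = 0) (x : R) :
    ∃! m, G.IsMaximalIn {i, j} x m :=
  h.existsUnique_isMaximalIn_of_orthogonal hG (b.cartanMatrix_apply_eq_zero_iff_pairing.mp hij)
    (b.cartanMatrix_apply_eq_zero_iff_pairing.mp hji) x

theorem existsUnique_isMaximalIn_of_cartanMatrix_eq_neg_one [Fintype ι] [P.IsRootSystem]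
    {i j : b.support}
    (hij : b.cartanMatrix i j = -1) (hji : b.cartanMatrix j i = -1) (x : R) :
    ∃! m, G.IsMaximalIn {i, j} x m := by
  have hcast (k l : b.support) : ((b.cartanMatrix k l : ℤ) : ℝ) = P.pairing k l :=
    b.algebraMap_cartanMatrixIn_apply ℤ k l
  refine h.existsUnique_isMaximalIn_of_pairing_eq_neg_one hG ?_ ?_ x
  · rw [← hcast, hij]; norm_num
  · rw [← hcast, hji]; norm_num

end IsWeightModel

variable [P.IsRootSystem]

/-- The orbit of the root `lam` contains a simple root α_i. At a vertex of weight α_i, 2ρ_i - l_i =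
2 with ρ_i ≤ l_i, so l_i ≥ 2. -/
theorem IsWeightModel.exists_two_le_compLength [Finite ι] [P.IsCrystallographic] [P.IsReduced]
    [P.IsIrreducible] {w f : R → M} (h : IsWeightModel G lam w f)
    (hG : ∀ i x y, G.Edge i x y → x ⋖ y) (ρ : RankFunction R) (hm : b.IsQuasiMinuscule lam) :
    ∃ i x, 2 ≤ ρ.compLength G i x := by
  obtain ⟨k, rfl, -⟩ := hm.exists_eq_root
  obtain ⟨i, hi, hik⟩ := b.exists_mem_orbit_simple_root k
  obtain ⟨x₀, hx₀⟩ := h.exists_eq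
  obtain ⟨x, -, hx⟩ := h.exists_mem_comp_wt_eq hx₀ hik
  refine ⟨⟨i, hi⟩, x, ?_⟩
  have hw := h.compWeight_eq ρ hG ⟨i, hi⟩ x
  rw [hx, root_coroot'_eq_pairing, pairing_same, RankFunction.compWeight] at hw
  have hw' : 2 * (ρ.compRank G ⟨i, hi⟩ x : ℤ) - (ρ.compLength G ⟨i, hi⟩ x : ℤ) = 2 := by
    exact_mod_cast hw
  have hle : ρ.compRank G ⟨i, hi⟩ x ≤ ρ.compLength G ⟨i, hi⟩ x :=
    Nat.sub_le_sub_right (ρ.rank_le_sSup EdgeColoredDigraph.mem_comp_self) _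
  omega

end RootPairing.Base

end

/-! ### The characterization theorem -/

theorem theorem4p16
    {ι M N : Type*} [Fintype ι] [AddCommGroup M] [Module ℝ M] [AddCommGroup N] [Module ℝ N]
    -- an irreducible finite (reduced, crystallographic) root system with a choice of simple roots
    (P : RootPairing ι ℝ M N) [P.IsRootSystem] [P.IsCrystallographic] [P.IsReduced]
    [P.IsIrreducible] (b : P.Base)
    -- a finite ranked poset whose Hasse diagram edges are colored by the simple roots
    {R : Type*} [PartialOrder R] [Finite R] (ρ : RankFunction R)
    (color : ∀ x y : R, x ⋖ y → b.support) (G : EdgeColoredDigraph b.support R)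
    (hG : G = EdgeColoredDigraph.ofColoring color) :
    -- the minuscule case
    ((∃ lam : M, b.IsDominant lam ∧ b.IsMinuscule lam ∧ G.Isomorphic (b.minusculePoset lam)) ↔
      (G.IsConnected ∧ G.IsFibrous ∧ b.IsStructured ρ G ∧
        (∃ i x y, G.Edge i x y) ∧
        (∀ i x, ρ.compLength G i x ≤ 1) ∧
        (∀ i j, b.cartanMatrix i j = 0 → b.cartanMatrix j i = 0 →
          ∀ x, ∃! m, G.IsMaximalIn {i, j} x m))) ∧
    ((∃ lam : M, b.IsDominant lam ∧ b.IsMinuscule lam ∧ G.Isomorphic (b.minusculePoset lam)) →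
      ∃ m : R, (∀ x, IsMax x ↔ x = m) ∧
        b.IsDominant (b.wt ρ G m) ∧ b.IsMinuscule (b.wt ρ G m) ∧
        G.Isomorphic (b.minusculePoset (b.wt ρ G m))) ∧
    -- the quasi-minuscule case; some monochromatic component has length at least two
    ((∃ lam : M, b.IsDominant lam ∧ b.IsQuasiMinuscule lam ∧
        G.Isomorphic (b.quasiMinusculePoset lam)) ↔
      (G.IsConnected ∧ G.IsFibrous ∧ b.IsStructured ρ G ∧
        (∃ i x y, G.Edge i x y) ∧
        (∃ i x, 2 ≤ ρ.compLength G i x) ∧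
        (∀ i x, 2 ≤ ρ.compLength G i x →
          ∃ x₀ x₁ x₂, G.comp {i} x = {x₀, x₁, x₂} ∧ G.Edge i x₀ x₁ ∧ G.Edge i x₁ x₂ ∧
            ∀ j, j ≠ i →
              ρ.compDepth G j x₀ = 0 ∧ ρ.compRank G j x₂ = 0 ∧ G.comp {j} x₁ = {x₁}) ∧
        (∀ i j, b.cartanMatrix i j = 0 → b.cartanMatrix j i = 0 →
          ∀ x, ∃! m, G.IsMaximalIn {i, j} x m) ∧
        (∀ i j, b.cartanMatrix i j = -1 → b.cartanMatrix j i = -1 →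
          ∀ x, ∃! m, G.IsMaximalIn {i, j} x m))) ∧
    ((∃ lam : M, b.IsDominant lam ∧ b.IsQuasiMinuscule lam ∧
        G.Isomorphic (b.quasiMinusculePoset lam)) →
      ∃ m : R, (∀ x, IsMax x ↔ x = m) ∧
        b.IsDominant (b.wt ρ G m) ∧ b.IsQuasiMinuscule (b.wt ρ G m) ∧
        G.Isomorphic (b.quasiMinusculePoset (b.wt ρ G m))) := by
  
  have hcov : ∀ i x y, G.Edge i x y → x ⋖ y := by
    subst hG
    rintro i x y ⟨h, -⟩
    exact h
  have hcov' : ∀ x y, x ⋖ y → ∃ i, G.Edge i x y := by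
    subst hG
    exact fun x y h ↦ ⟨_, h, rfl⟩
  have hmin : (∃ lam : M, b.IsDominant lam ∧ b.IsMinuscule lam ∧
      G.Isomorphic (b.minusculePoset lam)) → G.IsConnected ∧ G.IsFibrous ∧ b.IsStructured ρ G ∧
        (∃ i x y, G.Edge i x y) ∧ (∀ i x, ρ.compLength G i x ≤ 1) ∧
        (∀ i j, b.cartanMatrix i j = 0 → b.cartanMatrix j i = 0 →
          ∀ x, ∃! m, G.IsMaximalIn {i, j} x m) := by
    rintro ⟨lam, hd, hm, e, he⟩
    have h := RootPairing.Base.isWeightModel_of_minuscule hd hm e he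
    refine ⟨h.isConnected, h.isFibrous, h.isStructured ρ hcov, h.exists_edge, fun i x ↦ ?_,
      fun i j hij hji ↦ h.existsUnique_isMaximalIn_of_cartanMatrix_eq_zero hcov hij hji⟩
    by_contra! hl
    -- A long string would have a middle of weight zero, which does not lie in the orbit of a
    -- minuscule weight.
    obtain ⟨-, x₁, -, -, -, -, -, h0, -⟩ := h.string_of_two_le_compLength ρ hcov hl
    exact hm.ne_zero_of_mem_orbit (hm.weightDiagram_eq hd ▸ (e x₁).2) h0
  have hmin' (h : G.IsConnected ∧ G.IsFibrous ∧ b.IsStructured ρ G ∧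
        (∃ i x y, G.Edge i x y) ∧ (∀ i x, ρ.compLength G i x ≤ 1) ∧
        (∀ i j, b.cartanMatrix i j = 0 → b.cartanMatrix j i = 0 →
          ∀ x, ∃! m, G.IsMaximalIn {i, j} x m)) := by
    obtain ⟨h1, h2, h3, h4, h5, h6⟩ := h
    -- With all strings of length at most one, the condition on long strings is vacuous.
    have hs : b.IsLocallySplitting ρ G :=
      ⟨hcov, hcov', h1, h2, h3, h4, fun i x hl ↦ absurd (hl.trans (h5 i x)) (by norm_num)⟩
    exact hs.exists_max_minuscule h5 h6
  have hqm : (∃ lam : M, b.IsDominant lam ∧ b.IsQuasiMinuscule lam ∧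
      G.Isomorphic (b.quasiMinusculePoset lam)) → G.IsConnected ∧ G.IsFibrous ∧
        b.IsStructured ρ G ∧ (∃ i x y, G.Edge i x y) ∧ (∃ i x, 2 ≤ ρ.compLength G i x) ∧
        (∀ i x, 2 ≤ ρ.compLength G i x →
          ∃ x₀ x₁ x₂, G.comp {i} x = {x₀, x₁, x₂} ∧ G.Edge i x₀ x₁ ∧ G.Edge i x₁ x₂ ∧
            ∀ j, j ≠ i →
              ρ.compDepth G j x₀ = 0 ∧ ρ.compRank G j x₂ = 0 ∧ G.comp {j} x₁ = {x₁}) ∧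
        (∀ i j, b.cartanMatrix i j = 0 → b.cartanMatrix j i = 0 →
          ∀ x, ∃! m, G.IsMaximalIn {i, j} x m) ∧
        (∀ i j, b.cartanMatrix i j = -1 → b.cartanMatrix j i = -1 →
          ∀ x, ∃! m, G.IsMaximalIn {i, j} x m) := by
    rintro ⟨lam, hd, hm, e, he⟩
    have h := (RootPairing.Base.isWeightModel_quasiMinusculePoset hd hm).of_equiv e he
    exact ⟨h.isConnected, h.isFibrous, h.isStructured ρ hcov, h.exists_edge,
      h.exists_two_le_compLength hcov ρ hm, fun i x ↦ h.long ρ hcov,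
      fun i j hij hji ↦ h.existsUnique_isMaximalIn_of_cartanMatrix_eq_zero hcov hij hji,
      fun i j hij hji ↦ h.existsUnique_isMaximalIn_of_cartanMatrix_eq_neg_one hcov hij hji⟩
  refine ⟨⟨hmin, fun h ↦ ?_⟩, fun h ↦ hmin' (hmin h), ⟨hqm, fun h ↦ ?_⟩, fun h ↦ ?_⟩
  · obtain ⟨m, -, h⟩ := hmin' h
    exact ⟨_, h⟩
  · obtain ⟨h1, h2, h3, h4, h5, h6, h7, h8⟩ := h
    obtain ⟨m, -, h⟩ := RootPairing.Base.IsLocallySplitting.exists_max_quasiMinuscule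
      ⟨hcov, hcov', h1, h2, h3, h4, h6⟩ h5 h7 h8
    exact ⟨_, h⟩
  · obtain ⟨h1, h2, h3, h4, h5, h6, h7, h8⟩ := hqm h
    exact RootPairing.Base.IsLocallySplitting.exists_max_quasiMinuscule
      ⟨hcov, hcov', h1, h2, h3, h4, h6⟩ h5 h7 h8
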